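/- Consider the cascading bandit problem with $L$ items and lists of length $K$, $1\le K<L$, with click probabilities $1\ge w(1)\ge\dots\ge w(K)>w(K+1)\ge\dots\ge w(L)\ge 0$. In each round $t=1,2,\dots$ the agent shows an ordered list $S_t=(i^t_1,\dots,i^t_K)$ of $K$ distinct items. The click indicators $W_t(i)\sim\mathrm{Bern}(w(i))$ are independent over items and rounds and independent of the agent's randomization. The user examines the list from the first item on until the first click or the end of the list, and exactly the indicators of the examined items are observed. The expected reward of a list $S$ is $r(S)=1-\prod_{i\in S}(1-w(i))$, and the expected cumulative regret is $\mathrm{Reg}(T)=T\,r(1,\dots,K)-\sum_{t=1}^T\mathbb E[r(S_t)]$. The algorithm CTS keeps for each item parameters $\alpha_t(i),\beta_t(i)$, with $\alpha_1(i)=\beta_1(i)=1$. In round $t$ it draws $\theta_t(i)\sim\mathrm{Beta}(\alpha_t(i),\beta_t(i))$, independently over items given the past. It lists $K$ items by successively taking an item with the largest $\theta_t$ among those not yet taken. For each observed item $i$ it sets $\alpha_{t+1}(i)=\alpha_t(i)+W_t(i)$ and $\beta_{t+1}(i)=\beta_t(i)+1-W_t(i)$; the parameters of the other items are unchanged. Write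 $\Delta_{j,i}=w(j)-w(i)$. There is an absolute constant $a_2'>0$ (independent of $L$, $K$, $w$, $T$, $\varepsilon$) such that for every such problem instance, every $T$ and every $\varepsilon>0$ with $\Delta_{K,K+1}-2\varepsilon>0$, the regret of CTS satisfies $$\mathrm{Reg}(T)\le (L-K)\Big(1+\frac1{\varepsilon^2}\Big)+4\log T\sum_{i=K+1}^L\frac{\Delta_{K,i}-\varepsilon}{(\Delta_{K,i}-2\varepsilon)^2}+\sum_{i=K+1}^L\sum_{j=1}^K\Delta_{j,i}+\frac{a_2'}{\varepsilon^4}\sum_{j=1}^K\Delta_{j,L}.$$ In particular, with $\Delta=\Delta_{K,K+1}$ and the same constant $a_2'$, for every $T$ $$\mathrm{Reg}(T)\le 24\,\frac{(L-K)\log T}{\Delta}+\Big[(L-K)\Big(1+\frac9{\Delta^2}\Big)+\sum_{i=K+1}^L\sum_{j=1}^K\Delta_{j,i}+\frac{81\,a_2'}{\Delta^4}\sum_{j=1}^K\Delta_{j,L}\Big],$$ that is, $O((L-K)\log T/\Delta)$ up to terms that do not depend on $T$. -/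

import Mathlib

open MeasureTheory ProbabilityTheory

namespace CascadingBandit

/-- The sufficient statistics kept by the algorithm: `s i = (a, b)` means that item `i` has so far
been observed `a` times with a click and `b` times without a click.  The Beta parameters
of item `i` are then `a + 1` and `b + 1`. -/
abbrev Stats (L : ℕ) : Type := Fin L → ℕ × ℕ

/-- The first Beta parameter of item `i`; it starts at `1`. -/
def betaAlpha {L : ℕ} (s : Stats L) (i : Fin L) : ℕ := (s i).1 + 1

/-- The second Beta parameter of item `i`; it starts at `1`. -/
def betaBeta {L : ℕ} (s : Stats L) (i : Fin L) : ℕ := (s i).2 + 1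

/-- Given the statistics, the Thompson samples of the items are independent, and that of item `i`
has the Beta distribution with the current parameters of `i`. -/
noncomputable def thompsonLaw {L : ℕ} (s : Stats L) : Measure (Fin L → ℝ) :=
  Measure.pi fun i => betaMeasure (betaAlpha s i : ℝ) (betaBeta s i : ℝ)

/-- The law of the click indicators of one round: independent, and the indicator of item `i` is
`true` (click) with probability `w i`. -/
noncomputable def clickLaw {L : ℕ} (w : Fin L → unitInterval) : Measure (Fin L → Bool) :=
  Measure.pi fun i => bernoulliMeasure true false (w i)

/-- `sel θ` is, for every score vector `θ`, a list of `K` distinct items that is obtained by taking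
successively an item of maximal score among the items not yet taken (ties are broken by `sel`). -/
def IsGreedySelection {L K : ℕ} (sel : (Fin L → ℝ) → Fin K → Fin L) : Prop :=
  ∀ (θ : Fin L → ℝ) (k : Fin K), (∀ m < k, sel θ k ≠ sel θ m) ∧
    ∀ i : Fin L, (∀ m < k, i ≠ sel θ m) → θ i ≤ θ (sel θ k)

/-- The user examines the list `S` from its first item on and stops at the first click, so item `i`
is observed iff it is in the list and no earlier item of the list is clicked. -/
def Observed {L K : ℕ} (S : Fin K → Fin L) (W : Fin L → Bool) (i : Fin L) : Prop :=
  ∃ k : Fin K, S k = i ∧ ∀ m < k, W (S m) = false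

open Classical in
/-- The update of the statistics after the list `S` has been shown and the user's click indicators
are `W`: only the observed items are updated. -/
noncomputable def update {L K : ℕ} (s : Stats L) (S : Fin K → Fin L) (W : Fin L → Bool) :
    Stats L := fun i =>
  if Observed S W i then
    (if W i = true then ((s i).1 + 1, (s i).2) else ((s i).1, (s i).2 + 1))
  else s i

/-- One round of the algorithm: the law of the next statistics when the present ones are `s`.
Thompson samples `θ` are drawn, the list `sel θ` is shown, the click indicators `W` are drawn
independently of `θ` (and of the past), and the observed items are updated. -/
noncomputable def step {L K : ℕ} (w : Fin L → unitInterval) (sel : (Fin L → ℝ) → Fin K → Fin L)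
    (s : Stats L) : Measure (Stats L) :=
  ((thompsonLaw s).prod (clickLaw w)).map fun x => update s (sel x.1) x.2

/-- The law of the statistics after `t` rounds, that is, at the beginning of round `t + 1`. -/
noncomputable def statsLaw {L K : ℕ} (w : Fin L → unitInterval)
    (sel : (Fin L → ℝ) → Fin K → Fin L) : ℕ → Measure (Stats L)
  | 0 => Measure.dirac fun _ => (0, 0)
  | t + 1 => (statsLaw w sel t).bind (step w sel)

/-- The expected instantaneous reward of the list `S`: the probability of at least one click. -/
noncomputable def expectedReward {L K : ℕ} (w : Fin L → unitInterval) (S : Fin K → Fin L) : ℝ :=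
  1 - ∏ k, (1 - (w (S k) : ℝ))

/-- The list of the first `K` items, which is optimal when `w` is nonincreasing. -/
def firstItems {L K : ℕ} (hKL : K ≤ L) : Fin K → Fin L := Fin.castLE hKL

/-- The expected reward of the list shown in round `t + 1`. -/
noncomputable def roundReward {L K : ℕ} (w : Fin L → unitInterval)
    (sel : (Fin L → ℝ) → Fin K → Fin L) (t : ℕ) : ℝ :=
  ∫ s, ∫ θ, expectedReward w (sel θ) ∂(thompsonLaw s) ∂(statsLaw w sel t)

/-- The expected cumulative regret over `T` rounds of the Beta-Bernoulli combinatorial Thompson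
sampling algorithm, for nonincreasing click probabilities `w`. -/
noncomputable def regret {L K : ℕ} (hKL : K ≤ L) (w : Fin L → unitInterval)
    (sel : (Fin L → ℝ) → Fin K → Fin L) (T : ℕ) : ℝ :=
  T * expectedReward w (firstItems hKL) - ∑ t ∈ Finset.range T, roundReward w sel t

/-- The optimal items: the first `K` ones. -/
def optimalItems (L K : ℕ) : Finset (Fin L) := Finset.univ.filter fun j => (j : ℕ) < K

/-- The suboptimal items: all but the first `K` ones. -/
def suboptimalItems (L K : ℕ) : Finset (Fin L) := Finset.univ.filter fun i => K ≤ (i : ℕ)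

/-- The gap between the click probabilities of the items `j` and `i`. -/
noncomputable def gap {L : ℕ} (w : Fin L → unitInterval) (j i : Fin L) : ℝ := (w j : ℝ) - (w i : ℝ)

end CascadingBandit

/-! Decomposition of the loss. In a list `S`, every slot `k` holding a suboptimal item is matched
injectively with an optimal item `π k` that the list omits. Telescoping the two products of `1 - w`
bounds the loss by the sum over these slots of `gap w (π k) (S k)` times the probability that all
earlier slots go unclicked, which is exactly the probability that `S k` is observed
(`exists_matching`, `clickLaw_observed`). So loss is only paid at observations of suboptimal items,
and these are what the algorithm learns from.

Charging. When `i` is observed and `j` is missed, one of four things happens (`gap_le_charges`): the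
empirical mean of `i` is too high by `ε`; `i` has fewer than `log T / (gap w j i - 2 * ε) ^ 2`
observations; the sample of `i` exceeds `w j - ε` in spite of enough accurate data; or `j` is not
listed although an observed item has sample at most `w j - ε`. The first has a summable Chernoff
bound. The second sums to the logarithmic term. The third has conditional probability at most `1 /
T` in each round.

The fourth is the heart of the matter. Resampling only the score of `j` shows that its conditional
probability is at most the posterior odds of a sample of `j` being at most `y = w j - ε`, times the
probability that `j` is observed (`roundLaw_missed_le`). The odds are then summed along the
observations of `j`. By the Beta–binomial identity they are `1 / F - 1` with `F` a binomial
distribution function, and their averages over binomial data sum to order `ε⁻⁴`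
(`sum_binom_mul_odds_le`, `hasSum_odds_bound`).

Passage from rounds to observations. The click of an item is independent of whether it is observed,
so the successive observations of one item act as i.i.d. Bernoulli trials. The potential `totalCost`
makes this precise without stopping times (`sum_lintegral_obsProb_le`). -/

namespace CascadingBandit

open scoped ENNReal

variable {L K : ℕ}

/-! ### Binomial weights and Chernoff bounds -/

/-- The probability that a binomial variable with parameters `n` and `p` equals `b`. -/
noncomputable def binom (n : ℕ) (p : ℝ) (b : ℕ) : ℝ := n.choose b * p ^ b * (1 - p) ^ (n - b)

/-- The probability that a binomial variable with parameters `n` and `p` is at most `a`. -/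
noncomputable def binomCdf (n : ℕ) (p : ℝ) (a : ℕ) : ℝ := ∑ b ∈ Finset.range (a + 1), binom n p b

lemma binom_nonneg {n : ℕ} {p : ℝ} (h0 : 0 ≤ p) (h1 : p ≤ 1) (b : ℕ) : 0 ≤ binom n p b := by
  have : 0 ≤ 1 - p := by linarith
  unfold binom; positivity

lemma sum_binom_mul_exp (n : ℕ) (p l : ℝ) :
    ∑ b ∈ Finset.range (n + 1), binom n p b * Real.exp (l * b) =
      (1 - p + p * Real.exp l) ^ n := by
  rw [add_comm (1 - p), add_pow]
  refine Finset.sum_congr rfl fun b _ => ?_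
  rw [binom, mul_pow, mul_comm l, Real.exp_nat_mul]
  ring

lemma sum_binom (n : ℕ) (p : ℝ) : ∑ b ∈ Finset.range (n + 1), binom n p b = 1 := by
  simpa using sum_binom_mul_exp n p 0

/-- Hoeffding's lemma for a Bernoulli variable. -/
lemma bernoulli_mgf_le {p : ℝ} (h0 : 0 ≤ p) (h1 : p ≤ 1) (l : ℝ) :
    1 - p + p * Real.exp l ≤ Real.exp (p * l + l ^ 2 / 8) := by
  have hI : ∀ f : Bool → ℝ, ∫ x, f x ∂(bernoulliMeasure true false ⟨p, h0, h1⟩) =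
      p * f true + (1 - p) * f false := by
    intro f
    rw [integral_bernoulliMeasure]
    simp
  have h := (hasSubgaussianMGF_of_mem_Icc (μ := bernoulliMeasure true false ⟨p, h0, h1⟩)
    (X := fun x : Bool => if x then (1 : ℝ) else 0) (a := 0) (b := 1)
    (Measurable.of_discrete.aemeasurable)
    (Filter.Eventually.of_forall fun x => by cases x <;> simp)).mgf_le l
  simp only [mgf, hI] at h
  have e1 : Real.exp (p * l + l ^ 2 / 8) = Real.exp (l * p) * Real.exp (l ^ 2 / 8) := by
    rw [← Real.exp_add]; ring_nf
  have e2 : 1 - p + p * Real.exp l = Real.exp (l * p) *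
      (p * Real.exp (l * (1 - p)) + (1 - p) * Real.exp (l * (0 - p))) := by
    rw [mul_add, mul_left_comm, ← Real.exp_add, mul_left_comm, ← Real.exp_add,
      show l * p + l * (1 - p) = l by ring, show l * p + l * (0 - p) = 0 by ring, Real.exp_zero]
    ring
  rw [e1, e2]
  refine mul_le_mul_of_nonneg_left ?_ (Real.exp_pos _).le
  norm_num at h
  convert! h using 2 <;> ring_nf

lemma bernoulli_mgf_pow_le {p : ℝ} (h0 : 0 ≤ p) (h1 : p ≤ 1) (l : ℝ) (n : ℕ) :
    (1 - p + p * Real.exp l) ^ n ≤ Real.exp (n * (p * l + l ^ 2 / 8)) := by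
  rw [Real.exp_nat_mul]
  refine pow_le_pow_left₀ ?_ (bernoulli_mgf_le h0 h1 l) n
  have := Real.exp_pos l
  nlinarith [mul_nonneg h0 this.le]

/-- Exponential Markov inequality with parameter `4 * e`, the minimizer of `-l * e + l ^ 2 / 8`. -/
lemma binom_upper_tail_le {n : ℕ} {p e : ℝ} (h0 : 0 ≤ p) (h1 : p ≤ 1) (he : 0 ≤ e) :
    ∑ b ∈ Finset.range (n + 1), (if (p + e) * n < b then binom n p b else 0) ≤
      Real.exp (-(2 * n * e ^ 2)) := by
  calc _ ≤ ∑ b ∈ Finset.range (n + 1),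
        Real.exp (-(4 * e) * ((p + e) * n)) * (binom n p b * Real.exp ((4 * e) * b)) := by
        refine Finset.sum_le_sum fun b _ => ?_
        have hb := binom_nonneg h0 h1 (n := n) b
        split_ifs with h
        · rw [mul_left_comm, ← Real.exp_add]
          refine le_mul_of_one_le_right hb (Real.one_le_exp ?_)
          nlinarith
        · positivity
    _ = Real.exp (-(4 * e) * ((p + e) * n)) * (1 - p + p * Real.exp (4 * e)) ^ n := by
        rw [← Finset.mul_sum, sum_binom_mul_exp]
    _ ≤ Real.exp (-(4 * e) * ((p + e) * n)) * Real.exp (n * (p * (4 * e) + (4 * e) ^ 2 / 8)) :=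
        mul_le_mul_of_nonneg_left (bernoulli_mgf_pow_le h0 h1 _ n) (Real.exp_pos _).le
    _ = _ := by rw [← Real.exp_add]; ring_nf

lemma binom_eq_zero {n b : ℕ} (p : ℝ) (h : n < b) : binom n p b = 0 := by
  simp [binom, Nat.choose_eq_zero_of_lt h]

lemma binomCdf_le_exp {n a : ℕ} {x d : ℝ} (h0 : 0 ≤ x) (h1 : x ≤ 1) (hd : 0 ≤ d)
    (ha : (a : ℝ) ≤ (x - d) * n) (han : a ≤ n) :
    binomCdf n x a ≤ Real.exp (-(2 * n * d ^ 2)) := by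
  calc binomCdf n x a ≤ ∑ b ∈ Finset.range (a + 1),
        Real.exp ((4 * d) * a) * (binom n x b * Real.exp (-(4 * d) * b)) := by
        refine Finset.sum_le_sum fun b hb => ?_
        rw [mul_left_comm, ← Real.exp_add]
        refine le_mul_of_one_le_right (binom_nonneg h0 h1 b) (Real.one_le_exp ?_)
        have : (b : ℝ) ≤ a := by exact_mod_cast Nat.lt_succ_iff.mp (Finset.mem_range.mp hb)
        nlinarith
    _ ≤ ∑ b ∈ Finset.range (n + 1),
        Real.exp ((4 * d) * a) * (binom n x b * Real.exp (-(4 * d) * b)) := by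
        refine Finset.sum_le_sum_of_subset_of_nonneg (by
          apply Finset.range_mono; omega) fun b _ _ => ?_
        have := binom_nonneg h0 h1 (n := n) b
        positivity
    _ = Real.exp ((4 * d) * a) * (1 - x + x * Real.exp (-(4 * d))) ^ n := by
        rw [← Finset.mul_sum, sum_binom_mul_exp]
    _ ≤ Real.exp ((4 * d) * a) * Real.exp (n * (x * (-(4 * d)) + (-(4 * d)) ^ 2 / 8)) :=
        mul_le_mul_of_nonneg_left (bernoulli_mgf_pow_le h0 h1 _ n) (Real.exp_pos _).le
    _ ≤ _ := by
        rw [← Real.exp_add]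
        refine Real.exp_le_exp.mpr ?_
        nlinarith

/-! ### The mode, and a lower bound for the distribution function -/

lemma binom_succ_mul (n : ℕ) (p : ℝ) (b : ℕ) (hb : b < n) :
    binom n p (b + 1) * ((b + 1) * (1 - p)) = binom n p b * ((n - b) * p) := by
  have h := Nat.choose_succ_right_eq n b
  have h' : (n.choose (b + 1) : ℝ) * (b + 1) = n.choose b * (n - b) := by
    rw [← Nat.cast_sub hb.le]; exact_mod_cast h
  unfold binom
  have e : n - b = (n - (b + 1)) + 1 := by omega
  rw [e, pow_succ, pow_succ]
  linear_combination (p ^ b * p * ((1 - p) ^ (n - (b + 1)) * (1 - p))) * h'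

lemma binom_succ_left_mul (n : ℕ) (p : ℝ) (a : ℕ) (ha : a ≤ n) :
    binom (n + 1) p a * (n + 1 - a) = binom n p a * ((n + 1) * (1 - p)) := by
  have h := Nat.choose_mul_succ_eq n a
  have h' : (n.choose a : ℝ) * (n + 1) = (n + 1).choose a * (n + 1 - a) := by
    have : ((n + 1 - a : ℕ) : ℝ) = n + 1 - a := by
      rw [Nat.cast_sub (by omega)]; push_cast; ring
    rw [← this]; exact_mod_cast h
  unfold binom
  have e : n + 1 - a = (n - a) + 1 := by omega
  rw [e, pow_succ]
  linear_combination (-(p ^ a * ((1 - p) ^ (n - a) * (1 - p)))) * h'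

lemma floor_mul_le {n : ℕ} {p : ℝ} (h0 : 0 ≤ p) (h1 : p < 1) : ⌊((n : ℝ) + 1) * p⌋₊ ≤ n := by
  have hm1 : (⌊((n : ℝ) + 1) * p⌋₊ : ℝ) ≤ (n + 1) * p := Nat.floor_le (by positivity)
  have : (⌊((n : ℝ) + 1) * p⌋₊ : ℝ) < n + 1 := by
    have : (0 : ℝ) < n + 1 := by positivity
    nlinarith
  exact Nat.lt_succ_iff.mp (by exact_mod_cast this)

/-- `⌊(n + 1) p⌋` is a mode of the binomial distribution. -/
lemma binom_le_mode {n : ℕ} {p : ℝ} (h0 : 0 ≤ p) (h1 : p < 1) (b : ℕ) :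
    binom n p b ≤ binom n p ⌊(n + 1) * p⌋₊ := by
  set m := ⌊(n + 1) * p⌋₊ with hm
  have hpos : (0 : ℝ) ≤ (n + 1) * p := by positivity
  have hm1 : (m : ℝ) ≤ (n + 1) * p := Nat.floor_le hpos
  have hm2 : (n + 1) * p < m + 1 := Nat.lt_floor_add_one _
  have hmn : m ≤ n := floor_mul_le h0 h1
  rcases le_total b m with hbm | hbm
  · refine Nat.decreasingInduction' (P := fun b => binom n p b ≤ binom n p m)
      (fun k hk _ ih => le_trans ?_ ih) hbm le_rfl
    have hs := binom_succ_mul n p k (by omega)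
    have hk' : (k : ℝ) + 1 ≤ m := by exact_mod_cast hk
    have hc : ((k : ℝ) + 1) * (1 - p) ≤ (n - k) * p := by nlinarith
    have hpos' : 0 < ((k : ℝ) + 1) * (1 - p) := by
      have : 0 < 1 - p := by linarith
      positivity
    have := binom_nonneg h0 h1.le (n := n) k
    nlinarith
  · induction b, hbm using Nat.le_induction with
    | base => exact le_rfl
    | succ k hk ih =>
      refine le_trans ?_ ih
      rcases lt_or_ge k n with hkn | hkn
      · have hs := binom_succ_mul n p k hkn
        have hk' : (m : ℝ) ≤ k := by exact_mod_cast hk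
        have hc : (n - k) * p ≤ ((k : ℝ) + 1) * (1 - p) := by nlinarith
        have hpos' : 0 < ((k : ℝ) + 1) * (1 - p) := by
          have : 0 < 1 - p := by linarith
          positivity
        have := binom_nonneg h0 h1.le (n := n) k
        nlinarith
      · rw [binom_eq_zero p (by omega)]
        exact binom_nonneg h0 h1.le _

lemma one_le_succ_mul_binom_mode {n : ℕ} {p : ℝ} (h0 : 0 ≤ p) (h1 : p < 1) :
    1 ≤ (n + 1) * binom n p ⌊(n + 1) * p⌋₊ := by
  refine (sum_binom n p).symm.le.trans
    ((Finset.sum_le_card_nsmul _ _ _ fun b _ => binom_le_mode h0 h1 b).trans ?_)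
  simp

/-- The mode carries mass at least `1 / (n + 1)`. Passing from `n` to `n + 1` trials multiplies the
weight at `m` by `(n + 1) * (1 - y) / (n + 1 - m)`, and `n + 1 - m ≤ (n + 1) * (1 - y) + 1`; the
last `1` is absorbed by `(1 - y) / e ≥ 1`. -/
lemma one_le_mul_binomCdf {n a : ℕ} {y e : ℝ} (h0 : 0 ≤ y) (he : 0 < e) (h1 : y + e ≤ 1)
    (ha : ⌊((n : ℝ) + 1) * y⌋₊ ≤ a) : 1 ≤ (n + 1 + 1 / e) * binomCdf (n + 1) y a := by
  have h1' : y < 1 := by linarith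
  set m := ⌊((n : ℝ) + 1) * y⌋₊ with hm
  have hmn : m ≤ n := floor_mul_le h0 h1'
  have hm2 : (n + 1) * y < m + 1 := Nat.lt_floor_add_one _
  have hcdf : binom (n + 1) y m ≤ binomCdf (n + 1) y a :=
    Finset.single_le_sum (f := fun b => binom (n + 1) y b)
      (fun b _ => binom_nonneg h0 h1'.le b) (Finset.mem_range.mpr (by omega))
  have hmode := one_le_succ_mul_binom_mode (n := n) h0 h1'
  rw [← hm] at hmode
  have hs := binom_succ_left_mul n y m hmn
  have hB := binom_nonneg h0 h1'.le (n := n + 1) m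
  have hB' := binom_nonneg h0 h1'.le (n := n) m
  have h1y : e ≤ 1 - y := by linarith
  have hy : 0 < 1 - y := by linarith
  have key : (1 - y) * 1 ≤ (1 - y) * ((n + 1 + 1 / e) * binom (n + 1) y m) := by
    have h3 : (n + 1 - m : ℝ) ≤ (1 - y) * (n + 1 + 1 / e) := by
      have : 1 ≤ (1 - y) * (1 / e) := by
        rw [mul_one_div, le_div_iff₀ he]; linarith
      nlinarith
    calc (1 - y) * 1 ≤ (1 - y) * ((n + 1) * binom n y m) := by gcongr
      _ = binom (n + 1) y m * (n + 1 - m) := by rw [hs]; ring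
      _ ≤ binom (n + 1) y m * ((1 - y) * (n + 1 + 1 / e)) := by gcongr
      _ = _ := by ring
  refine (le_of_mul_le_mul_left key hy).trans ?_
  gcongr

lemma binomCdf_pos {n a : ℕ} {y : ℝ} (h0 : 0 ≤ y) (h1 : y < 1) : 0 < binomCdf n y a := by
  refine lt_of_lt_of_le ?_ (Finset.single_le_sum (f := fun b => binom n y b)
      (fun b _ => binom_nonneg h0 h1.le b) (Finset.mem_range.mpr (Nat.succ_pos a)))
  have : 0 < 1 - y := by linarith
  simp [binom, this]

lemma binomCdf_le_one {n a : ℕ} {y : ℝ} (h0 : 0 ≤ y) (h1 : y ≤ 1) (ha : a ≤ n) :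
    binomCdf n y a ≤ 1 := by
  rw [← sum_binom n y]
  exact Finset.sum_le_sum_of_subset_of_nonneg (Finset.range_mono (by omega))
    fun b _ _ => binom_nonneg h0 h1 b

/-! ### Posterior odds averaged over binomial data -/

lemma one_sub_le_exp_neg_sub_sq {s : ℝ} (h0 : 0 ≤ s) (h1 : s ≤ 1) :
    1 - s ≤ Real.exp (-(s + s ^ 2 / 2)) := by
  rcases h1.eq_or_lt with rfl | h1
  · simpa using (Real.exp_pos _).le
  have hlog : Real.log (1 - s) ≤ -(s + s ^ 2 / 2) := by
    have h := Real.hasSum_pow_div_log_of_abs_lt_one (x := s) (by rw [abs_of_nonneg h0]; exact h1)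
    have := sum_le_hasSum (Finset.range 2) (fun i _ => by positivity) h
    norm_num [Finset.sum_range_succ] at this
    linarith
  calc 1 - s = Real.exp (Real.log (1 - s)) := (Real.exp_log (by linarith)).symm
    _ ≤ _ := Real.exp_le_exp.mpr hlog

/-- The likelihood ratio of the binomial distributions with parameters `y + e` and `y` at a point
below the mean of the latter. -/
lemma likelihood_ratio_le {n k : ℕ} {y e : ℝ} (hy : 0 < y) (he : 0 < e) (h1 : y + e ≤ 1)
    (hk : (k : ℝ) ≤ n * y) (hkn : k ≤ n) :
    ((y + e) / y) ^ k * ((1 - (y + e)) / (1 - y)) ^ (n - k) ≤ Real.exp (-(e ^ 2 / 2)) ^ n := by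
  have hy1 : 0 < 1 - y := by linarith
  set s := e / (1 - y) with hs
  have hse : s * (1 - y) = e := by rw [hs]; field_simp
  have hs0 : 0 < s := by positivity
  have hs1 : s ≤ 1 := by rw [hs, div_le_one hy1]; linarith
  have hes : e ≤ s := by nlinarith
  have e1 : (y + e) / y ≤ Real.exp (e / y) := by
    have := Real.add_one_le_exp (e / y)
    have h2 : (y + e) / y = e / y + 1 := by field_simp; ring
    rw [h2]; exact this
  have e2 : (1 - (y + e)) / (1 - y) ≤ Real.exp (-(s + s ^ 2 / 2)) := by
    have h2 : (1 - (y + e)) / (1 - y) = 1 - s := by rw [hs]; field_simp; ring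
    rw [h2]; exact one_sub_le_exp_neg_sub_sq hs0.le hs1
  have hv : 0 ≤ (1 - (y + e)) / (1 - y) := div_nonneg (by linarith) hy1.le
  calc _ ≤ Real.exp (e / y) ^ k * Real.exp (-(s + s ^ 2 / 2)) ^ (n - k) := by gcongr
    _ = Real.exp (k * (e / y) + (n - k : ℕ) * (-(s + s ^ 2 / 2))) := by
        rw [← Real.exp_nat_mul, ← Real.exp_nat_mul, ← Real.exp_add]
    _ ≤ Real.exp (n * (-(e ^ 2 / 2))) := by
        refine Real.exp_le_exp.mpr ?_
        rw [Nat.cast_sub hkn]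
        have h3 : k * (e / y) ≤ n * e := by
          rw [mul_div_assoc', div_le_iff₀ hy]; nlinarith
        have h4 : (n : ℝ) * (1 - y) ≤ n - k := by linarith
        have h5 : (n : ℝ) * (1 - y) * (s + s ^ 2 / 2) ≤ (n - k) * (s + s ^ 2 / 2) := by gcongr
        -- The first-order term `n * e` cancels against `h3`; the decay comes from the quadratic
        -- term of `one_sub_le_exp_neg_sub_sq`.
        have h6 : (n : ℝ) * (1 - y) * (s + s ^ 2 / 2) = n * (e + e * s / 2) := by
          rw [← hse]; ring
        have h7 : (n : ℝ) * (e + e * s / 2) ≥ n * (e + e * e / 2) := by gcongr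
        nlinarith
    _ = _ := by rw [Real.exp_nat_mul]

/-- The ratios grow geometrically in `a`, so the last one dominates. Since `(y + e) * (1 - y) - y *
(1 - (y + e)) = e`, the sum is controlled by induction without dividing by `1 - (y + e)`, which may
vanish. -/
lemma sum_likelihood_ratio_le {n k : ℕ} {y e : ℝ} (hy : 0 < y) (he : 0 < e) (h1 : y + e ≤ 1)
    (hkn : k ≤ n) :
    ∑ a ∈ Finset.range (k + 1), ((y + e) / y) ^ a * ((1 - (y + e)) / (1 - y)) ^ (n - a) / (1 - y) ≤
      1 / e * (((y + e) / y) ^ k * ((1 - (y + e)) / (1 - y)) ^ (n - k)) := by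
  have hy1 : 0 < 1 - y := by linarith
  set r : ℕ → ℝ := fun a => ((y + e) / y) ^ a * ((1 - (y + e)) / (1 - y)) ^ (n - a) with hr
  have hr0 : ∀ a, 0 ≤ r a := fun a => by
    have hv : 0 ≤ (1 - (y + e)) / (1 - y) := div_nonneg (by linarith) hy1.le
    simp only [hr]; positivity
  have hstep : ∀ a, a < n → (y + e) * (1 - y) * r a = y * (1 - (y + e)) * r (a + 1) := by
    intro a ha
    simp only [hr]
    have e0 : n - a = (n - (a + 1)) + 1 := by omega
    rw [e0, pow_succ, pow_succ]
    field_simp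
  have hmain : ∀ k, k ≤ n → e * ∑ a ∈ Finset.range (k + 1), r a ≤ (y + e) * (1 - y) * r k := by
    intro k
    induction k with
    | zero =>
      intro _
      have := hr0 0
      simp only [zero_add, Finset.sum_range_one]
      have : e ≤ (y + e) * (1 - y) := by nlinarith
      gcongr
    | succ k ih =>
      intro hk
      rw [Finset.sum_range_succ, mul_add]
      have := ih (by omega)
      have h2 := hstep k (by omega)
      nlinarith
  have h := hmain k hkn
  rw [← Finset.sum_div, div_le_iff₀ hy1, one_div, inv_mul_eq_div, div_mul_eq_mul_div, le_div_iff₀ he]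
  have h2 : (y + e) * (1 - y) * r k ≤ 1 * (1 - y) * r k := by
    have := hr0 k
    gcongr
  simp only [hr] at h h2 ⊢
  linarith

/-- The distribution function is bounded below by its last summand, which is at least `(1 - y) *
binom n y a`; what remains is a likelihood ratio. -/
lemma binom_div_binomCdf_le {n a : ℕ} {y e : ℝ} (hy : 0 < y) (he : 0 < e) (h1 : y + e ≤ 1)
    (han : a ≤ n) : binom n (y + e) a / binomCdf (n + 1) y a ≤
      ((y + e) / y) ^ a * ((1 - (y + e)) / (1 - y)) ^ (n - a) / (1 - y) := by
  have hy1 : 0 < 1 - y := by linarith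
  have hv : 0 ≤ (1 - (y + e)) / (1 - y) := div_nonneg (by linarith) hy1.le
  have hF : binom (n + 1) y a ≤ binomCdf (n + 1) y a :=
    Finset.single_le_sum (f := fun b => binom (n + 1) y b)
      (fun b _ => binom_nonneg hy.le (by linarith) b) (Finset.mem_range.mpr (Nat.lt_succ_self a))
  have hs := binom_succ_left_mul n y a han
  have hB := binom_nonneg hy.le (by linarith) (n := n) a
  have hB1 := binom_nonneg hy.le (by linarith) (n := n + 1) a
  have han' : (a : ℝ) ≤ n := by exact_mod_cast han
  have h2 : binom n y a * (1 - y) ≤ binom (n + 1) y a := by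
    have hn : (0 : ℝ) < n + 1 := by positivity
    have ha0 : (0 : ℝ) ≤ a := by positivity
    refine le_of_mul_le_mul_right ?_ hn
    nlinarith [mul_nonneg hB1 ha0]
  have h3 : binom n (y + e) a =
      binom n y a * (((y + e) / y) ^ a * ((1 - (y + e)) / (1 - y)) ^ (n - a)) := by
    unfold binom
    rw [div_pow, div_pow]
    field_simp
  rw [div_le_div_iff₀ (binomCdf_pos hy.le (by linarith)) hy1, h3]
  calc _ = (((y + e) / y) ^ a * ((1 - (y + e)) / (1 - y)) ^ (n - a)) *
        (binom n y a * (1 - y)) := by ring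
    _ ≤ _ := by gcongr; exact h2.trans hF

/-- A binomial variable exceeds an independent one of larger success probability with
exponentially small probability. -/
lemma sum_binom_mul_one_sub_binomCdf_le {n : ℕ} {y e : ℝ} (hy : 0 ≤ y) (he : 0 < e)
    (h1 : y + e ≤ 1) :
    ∑ a ∈ Finset.range (n + 1), binom n (y + e) a * (1 - binomCdf (n + 1) y a) ≤
      Real.exp 2 * Real.exp (-(e ^ 2 / 2)) ^ n := by
  have hle : ∀ a ∈ Finset.range (n + 1), binom n (y + e) a * (1 - binomCdf (n + 1) y a) ≤
      ∑ b ∈ Finset.range (n + 1 + 1),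
        (binom n (y + e) a * Real.exp (-e * a)) * (binom (n + 1) y b * Real.exp (e * b)) := by
    intro a ha
    have han : a < n + 1 := Finset.mem_range.mp ha
    have hB := binom_nonneg (p := y + e) (by linarith) h1 (n := n) a
    have e1 : 1 - binomCdf (n + 1) y a =
        ∑ b ∈ Finset.Ico (a + 1) (n + 1 + 1), binom (n + 1) y b := by
      rw [Finset.sum_Ico_eq_sub _ (by omega), sum_binom, binomCdf]
    rw [e1, Finset.mul_sum]
    refine (Finset.sum_le_sum fun b hb => ?_).trans
      (Finset.sum_le_sum_of_subset_of_nonneg (s := Finset.Ico (a + 1) (n + 1 + 1)) ?_ ?_)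
    · have hab : a + 1 ≤ b := (Finset.mem_Ico.mp hb).1
      have hab' : (a : ℝ) ≤ b := by exact_mod_cast (by omega : a ≤ b)
      have hB2 := binom_nonneg (p := y) (by linarith) (by linarith) (n := n + 1) b
      rw [mul_mul_mul_comm, ← Real.exp_add]
      refine le_mul_of_one_le_right (by positivity) (Real.one_le_exp ?_)
      nlinarith
    · intro b hb
      exact Finset.mem_range.mpr (Finset.mem_Ico.mp hb).2
    · intro b _ _
      have hB2 := binom_nonneg (p := y) (by linarith) (by linarith) (n := n + 1) b
      positivity
  refine (Finset.sum_le_sum hle).trans ?_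
  rw [← Finset.sum_mul_sum, sum_binom_mul_exp, sum_binom_mul_exp]
  have hm1 := bernoulli_mgf_pow_le (p := y + e) (by linarith) h1 (-e) n
  have hm2 := bernoulli_mgf_pow_le (p := y) hy (by linarith) e (n + 1)
  calc _ ≤ Real.exp (n * ((y + e) * (-e) + (-e) ^ 2 / 8)) *
        Real.exp ((n + 1 : ℕ) * (y * e + e ^ 2 / 8)) := by
        refine mul_le_mul hm1 hm2 (pow_nonneg ?_ _) (Real.exp_pos _).le
        have : 0 ≤ 1 - y := by linarith
        positivity
    _ ≤ Real.exp (2 + n * (-(e ^ 2 / 2))) := by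
        rw [← Real.exp_add]
        refine Real.exp_le_exp.mpr ?_
        push_cast
        -- The contribution of the one extra trial; it accounts for the factor `Real.exp 2`.
        have h8 : y * e + e ^ 2 / 8 ≤ 2 := by nlinarith
        have : (0 : ℝ) ≤ n * e ^ 2 := by positivity
        nlinarith
    _ = _ := by rw [Real.exp_add, Real.exp_nat_mul]

/-- The expectation, over a binomial variable with parameter `y + e`, of the odds against exceeding
`y` under the corresponding posterior. -/
lemma sum_binom_mul_odds_le {n : ℕ} {y e : ℝ} (hy : 0 < y) (he : 0 < e) (h1 : y + e ≤ 1) :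
    ∑ a ∈ Finset.range (n + 1), binom n (y + e) a * (1 / binomCdf (n + 1) y a - 1) ≤
      (1 / e + (n + 1 + 1 / e) * Real.exp 2) * Real.exp (-(e ^ 2 / 2)) ^ n := by
  have hy1 : y < 1 := by linarith
  have hBn : ∀ a, 0 ≤ binom n (y + e) a := fun a => binom_nonneg (by linarith) h1 a
  set m := ⌊((n : ℝ) + 1) * y⌋₊ with hm
  have hmn : m ≤ n := floor_mul_le hy.le hy1
  have hm1 : (m : ℝ) ≤ (n + 1) * y := Nat.floor_le (by positivity)
  -- Below the mode `m` of parameter `y`, `F` may be tiny but the data are unlikely, so likelihood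
  -- ratios are used. From `m` on, `1 / F` is at most `n + 1 + 1 / e` and `1 - F` is small on
  -- average.
  rw [← Finset.sum_range_add_sum_Ico _ (show m ≤ n + 1 by omega), add_mul]
  refine add_le_add ?_ ?_
  · have hle : ∑ a ∈ Finset.range m, binom n (y + e) a * (1 / binomCdf (n + 1) y a - 1) ≤
        ∑ a ∈ Finset.range m,
          ((y + e) / y) ^ a * ((1 - (y + e)) / (1 - y)) ^ (n - a) / (1 - y) := by
      refine Finset.sum_le_sum fun a ha => ?_
      have ham : a < m := Finset.mem_range.mp ha
      refine le_trans ?_ (binom_div_binomCdf_le hy he h1 (by omega))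
      rw [mul_sub, mul_one_div, mul_one]
      linarith [hBn a]
    refine hle.trans ?_
    rcases m with _ | k
    · simp; positivity
    · refine (sum_likelihood_ratio_le hy he h1 (by omega)).trans ?_
      gcongr
      -- Here `m = k + 1 ≤ (n + 1) * y` and `y < 1`, hence `k ≤ n * y`.
      refine likelihood_ratio_le hy he h1 ?_ (by omega)
      push_cast at hm1
      linarith
  · have hle : ∀ a ∈ Finset.Ico m (n + 1),
        binom n (y + e) a * (1 / binomCdf (n + 1) y a - 1) ≤
          (n + 1 + 1 / e) * (binom n (y + e) a * (1 - binomCdf (n + 1) y a)) := by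
      intro a ha
      obtain ⟨h2, h3⟩ := Finset.mem_Ico.mp ha
      have hF := binomCdf_pos (n := n + 1) (a := a) hy.le hy1
      have hF1 := binomCdf_le_one (n := n + 1) (a := a) hy.le hy1.le (by omega)
      have hone := one_le_mul_binomCdf (n := n) (a := a) hy.le he h1 h2
      have e1 : 1 / binomCdf (n + 1) y a - 1 =
          1 / binomCdf (n + 1) y a * (1 - binomCdf (n + 1) y a) := by field_simp
      have e2 : 1 / binomCdf (n + 1) y a ≤ n + 1 + 1 / e := by rwa [div_le_iff₀ hF]
      rw [e1, mul_left_comm]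
      refine mul_le_mul_of_nonneg_right e2 (mul_nonneg (hBn a) (by linarith))
    refine (Finset.sum_le_sum hle).trans ?_
    rw [← Finset.mul_sum, mul_assoc]
    refine mul_le_mul_of_nonneg_left (le_trans ?_
      (sum_binom_mul_one_sub_binomCdf_le (n := n) hy.le he h1)) (by positivity)
    refine Finset.sum_le_sum_of_subset_of_nonneg
      (fun b hb => Finset.mem_range.mpr (Finset.mem_Ico.mp hb).2) fun a ha _ => ?_
    have := binomCdf_le_one (n := n + 1) (a := a) hy.le hy1.le
      (by have := Finset.mem_range.mp ha; omega)
    exact mul_nonneg (hBn a) (by linarith)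

lemma exp_neg_sq_le {e : ℝ} (he1 : e ≤ 1) (he : 0 < e) :
    Real.exp (-(e ^ 2 / 2)) ≤ 1 - e ^ 2 / 4 := by
  rw [Real.exp_neg, inv_le_comm₀ (Real.exp_pos _) (by nlinarith)]
  refine le_trans ?_ (Real.add_one_le_exp _)
  rw [inv_le_iff_one_le_mul₀ (by nlinarith)]
  nlinarith [sq_nonneg e, mul_nonneg (sq_nonneg e) (sub_nonneg.mpr (show e ^ 2 ≤ 1 by nlinarith))]

/-- The bounds of `sum_binom_mul_odds_le` are summable, with a sum of order `e⁻⁴`. -/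
lemma hasSum_odds_bound {e : ℝ} (he1 : e ≤ 1) (he : 0 < e) :
    ∃ B : ℝ, B ≤ (4 + 20 * Real.exp 2) / e ^ 4 ∧
      HasSum (fun n : ℕ => (1 / e + (n + 1 + 1 / e) * Real.exp 2) * Real.exp (-(e ^ 2 / 2)) ^ n)
        B := by
  set q := Real.exp (-(e ^ 2 / 2)) with hq
  have hq0 : 0 < q := Real.exp_pos _
  have hq1 : e ^ 2 / 4 ≤ 1 - q := by linarith [exp_neg_sq_le he1 he]
  have he2 : 0 < e ^ 2 / 4 := by positivity
  have hq2 : q < 1 := by linarith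
  have s1 : HasSum (fun n : ℕ => q ^ n) (1 - q)⁻¹ := hasSum_geometric_of_lt_one hq0.le hq2
  have s2 : HasSum (fun n : ℕ => ((n : ℝ) + 1) * q ^ n) (1 / (1 - q) ^ 2) := by
    have := hasSum_choose_mul_geometric_of_norm_lt_one 1 (r := q)
      (by rw [Real.norm_eq_abs, abs_of_pos hq0]; exact hq2)
    simpa using this
  refine ⟨(1 / e + 1 / e * Real.exp 2) * (1 - q)⁻¹ + Real.exp 2 * (1 / (1 - q) ^ 2), ?_, ?_⟩
  · have h1 : (1 - q)⁻¹ ≤ 4 / e ^ 2 := by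
      rw [show 4 / e ^ 2 = (e ^ 2 / 4)⁻¹ by rw [inv_div]]
      exact inv_anti₀ he2 hq1
    have h2 : 1 / (1 - q) ^ 2 ≤ 16 / e ^ 4 := by
      rw [one_div, ← inv_pow]
      calc (1 - q)⁻¹ ^ 2 ≤ (4 / e ^ 2) ^ 2 :=
            pow_le_pow_left₀ (inv_nonneg.mpr (by linarith)) h1 2
        _ = _ := by rw [div_pow]; ring
    have hE := Real.exp_pos 2
    calc _ ≤ (1 / e + 1 / e * Real.exp 2) * (4 / e ^ 2) + Real.exp 2 * (16 / e ^ 4) := by gcongr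
      _ = ((4 + 4 * Real.exp 2) * e + 16 * Real.exp 2) / e ^ 4 := by field_simp
      _ ≤ _ := div_le_div_of_nonneg_right (by nlinarith) (by positivity)
  · convert! (s1.mul_left (1 / e + 1 / e * Real.exp 2)).add (s2.mul_left (Real.exp 2)) using 1
    funext n
    ring

/-! ### The Beta–binomial identity -/

lemma binom_eq_eval (n : ℕ) (p : ℝ) (b : ℕ) :
    binom n p b = (bernsteinPolynomial ℝ n b).eval p := by
  simp [binom, bernsteinPolynomial]

/-- The derivative of each Bernstein polynomial is a difference of two neighbours of lower degree,
so the sum telescopes. -/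
lemma derivative_sum_bernstein (n a : ℕ) :
    Polynomial.derivative (∑ b ∈ Finset.range (a + 1), bernsteinPolynomial ℝ (n + 1) b) =
      -((n + 1 : ℕ) : Polynomial ℝ) * bernsteinPolynomial ℝ n a := by
  induction a with
  | zero => simp [bernsteinPolynomial.derivative_zero]
  | succ a ih =>
    rw [Finset.sum_range_succ, map_add, ih, bernsteinPolynomial.derivative_succ]
    simp only [Nat.add_sub_cancel]
    ring

lemma hasDerivAt_binomCdf (n a : ℕ) (x : ℝ) :
    HasDerivAt (fun x => binomCdf (n + 1) x a) (-((n + 1) * binom n x a)) x := by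
  have h := (∑ b ∈ Finset.range (a + 1), bernsteinPolynomial ℝ (n + 1) b).hasDerivAt x
  rw [derivative_sum_bernstein] at h
  have e : (fun x => (∑ b ∈ Finset.range (a + 1), bernsteinPolynomial ℝ (n + 1) b).eval x) =
      fun x => binomCdf (n + 1) x a := by
    funext x
    simp [binomCdf, binom_eq_eval, Polynomial.eval_finsetSum]
  rw [e] at h
  refine h.congr_deriv ?_
  simp [binom_eq_eval]
  ring

lemma integral_binom {n a : ℕ} (han : a ≤ n) (x : ℝ) :
    ∫ t in x..1, (n + 1) * binom n t a = binomCdf (n + 1) x a := by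
  have hc : Continuous fun t : ℝ => ((n : ℝ) + 1) * binom n t a := by
    unfold binom; fun_prop
  have h := intervalIntegral.integral_eq_sub_of_hasDerivAt (a := x) (b := 1)
    (f := fun x => -binomCdf (n + 1) x a) (f' := fun t => (n + 1) * binom n t a)
    (fun t _ => by simpa using (hasDerivAt_binomCdf n a t).fun_neg) (hc.intervalIntegrable _ _)
  rw [h]
  have : binomCdf (n + 1) 1 a = 0 := by
    refine Finset.sum_eq_zero fun b hb => ?_
    have hb' := Finset.mem_range.mp hb
    have : n + 1 - b ≠ 0 := by omega
    simp [binom, this]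
  simp [this]

lemma betaPDF_nat {a b : ℕ} {t : ℝ} (ht : t ∈ Set.Ioo (0 : ℝ) 1) :
    betaPDF ((a + 1 : ℕ) : ℝ) ((b + 1 : ℕ) : ℝ) t =
      ENNReal.ofReal (((a + b : ℕ) + 1) * binom (a + b) t a) := by
  rw [betaPDF_of_pos_lt_one ht.1 ht.2]
  congr 1
  have h1 : beta ((a + 1 : ℕ) : ℝ) ((b + 1 : ℕ) : ℝ) =
      (a.factorial * b.factorial : ℝ) / (a + b + 1).factorial := by
    unfold beta
    rw [Nat.cast_succ, Nat.cast_succ, Real.Gamma_nat_eq_factorial, Real.Gamma_nat_eq_factorial,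
      show (a : ℝ) + 1 + (b + 1) = (a + b + 1 : ℕ) + 1 by push_cast; ring,
      Real.Gamma_nat_eq_factorial]
  have h2 : ((a + b).choose a : ℝ) * (a.factorial * b.factorial) = (a + b).factorial := by
    have := Nat.add_choose_mul_factorial_mul_factorial a b
    rw [← Nat.choose_symm_add] at this
    rw [← mul_assoc]; exact_mod_cast this
  have h3 : ((a + b + 1).factorial : ℝ) = (a + b + 1) * (a + b).factorial := by
    rw [Nat.factorial_succ]; push_cast; ring
  rw [h1]
  have hp : ((a + 1 : ℕ) : ℝ) - 1 = (a : ℕ) := by push_cast; ring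
  have hp' : ((b + 1 : ℕ) : ℝ) - 1 = (b : ℕ) := by push_cast; ring
  rw [hp, hp', Real.rpow_natCast, Real.rpow_natCast, binom, Nat.add_sub_cancel_left, one_div,
    inv_div, h3, ← h2]
  push_cast
  field_simp

/-- The Beta–binomial identity. -/
lemma betaMeasure_Ioi {a b : ℕ} {x : ℝ} (h0 : 0 ≤ x) (h1 : x ≤ 1) :
    betaMeasure ((a + 1 : ℕ) : ℝ) ((b + 1 : ℕ) : ℝ) (Set.Ioi x) =
      ENNReal.ofReal (binomCdf (a + b + 1) x a) := by
  have hc : Continuous fun t : ℝ => (((a + b : ℕ) : ℝ) + 1) * binom (a + b) t a := by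
    unfold binom; fun_prop
  have e1 : betaPDF ((a + 1 : ℕ) : ℝ) ((b + 1 : ℕ) : ℝ) = (Set.Ioo (0 : ℝ) 1).indicator
      fun t => ENNReal.ofReal (((a + b : ℕ) + 1) * binom (a + b) t a) := by
    funext t
    by_cases ht : t ∈ Set.Ioo (0 : ℝ) 1
    · rw [Set.indicator_of_mem ht, betaPDF_nat ht]
    · rw [Set.indicator_of_notMem ht]
      rcases le_or_gt t 0 with h | h
      · exact betaPDF_eq_zero_of_nonpos h
      · exact betaPDF_eq_zero_of_one_le (not_lt.mp fun h' => ht ⟨h, h'⟩)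
  have e2 : Set.Ioo (0 : ℝ) 1 ∩ Set.Ioi x = Set.Ioo x 1 := by
    ext t
    simp only [Set.mem_inter_iff, Set.mem_Ioo, Set.mem_Ioi]
    constructor
    · rintro ⟨⟨_, h⟩, h'⟩; exact ⟨h', h⟩
    · rintro ⟨h', h⟩; exact ⟨⟨by linarith, h⟩, h'⟩
  rw [betaMeasure, withDensity_apply _ measurableSet_Ioi, e1,
    setLIntegral_indicator measurableSet_Ioo, e2, ← integral_binom (by omega : a ≤ a + b) x,
    intervalIntegral.integral_of_le h1, restrict_Ioo_eq_restrict_Ioc,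
    ofReal_integral_eq_lintegral_ofReal]
  · exact (hc.integrableOn_Icc (a := x) (b := 1)).mono_set Set.Ioc_subset_Icc_self
  · filter_upwards [ae_restrict_mem measurableSet_Ioc] with t ht
    have := binom_nonneg (p := t) (by linarith [ht.1]) ht.2 (n := a + b) a
    positivity

/-! ### Resampling and independence within a round -/

/-- Resampling one coordinate of a random vector with independent coordinates. -/
lemma lintegral_pi_update {ι : Type*} [Fintype ι] [DecidableEq ι] {X : ι → Type*}
    [∀ i, MeasurableSpace (X i)] (μ : ∀ i, Measure (X i)) [∀ i, IsProbabilityMeasure (μ i)]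
    {f : (∀ i, X i) → ℝ≥0∞} (hf : Measurable f) (i : ι) :
    ∫⁻ x, f x ∂Measure.pi μ =
      ∫⁻ x, ∫⁻ u, f (Function.update x i u) ∂μ i ∂Measure.pi μ := by
  refine lintegral_eq_of_lmarginal_eq {i} hf ?_ ?_
  · have h := hf.lmarginal μ (s := {i})
    have e : (∫⋯∫⁻_{i}, f ∂μ) = fun x => ∫⁻ u, f (Function.update x i u) ∂μ i := by
      funext x; rw [lmarginal_singleton]
    rwa [e] at h
  · funext x
    rw [lmarginal_singleton, lmarginal_singleton]
    simp

instance (s : Stats L) (i : Fin L) :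
    IsProbabilityMeasure (betaMeasure (betaAlpha s i : ℝ) (betaBeta s i : ℝ)) :=
  isProbabilityMeasureBeta (by unfold betaAlpha; positivity) (by unfold betaBeta; positivity)

instance (s : Stats L) : IsProbabilityMeasure (thompsonLaw s) := by
  unfold thompsonLaw; infer_instance

instance (w : Fin L → unitInterval) : IsProbabilityMeasure (clickLaw w) := by
  unfold clickLaw; infer_instance

lemma IsGreedySelection.injective {sel : (Fin L → ℝ) → Fin K → Fin L}
    (h : IsGreedySelection sel) (θ : Fin L → ℝ) : Function.Injective (sel θ) := by
  intro k m hkm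
  rcases lt_trichotomy k m with hlt | rfl | hlt
  · exact absurd hkm.symm ((h θ m).1 k hlt)
  · rfl
  · exact absurd hkm ((h θ k).1 m hlt)

/-- Observation of `i` depends only on clicks of earlier, different items. This makes the click of
`i` independent of its being observed. -/
lemma observed_update_iff {S : Fin K → Fin L} (hS : Function.Injective S) (W : Fin L → Bool)
    (i : Fin L) (u : Bool) : Observed S (Function.update W i u) i ↔ Observed S W i := by
  refine exists_congr fun k => and_congr_right fun hk => forall₂_congr fun m hm => ?_
  rw [Function.update_of_ne]
  rw [← hk]
  exact fun h => hm.ne (hS h)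

/-! ### The potential of future observations -/

/-- The expectation of `h` after one observation of an item of click probability `p`. -/
noncomputable def clickAvg (p : unitInterval) (h : ℕ × ℕ → ℝ≥0∞) (c : ℕ × ℕ) : ℝ≥0∞ :=
  ENNReal.ofReal p * h (c.1 + 1, c.2) + ENNReal.ofReal (1 - p) * h (c.1, c.2 + 1)

/-- The expected sum of `h` over all future observations of an item of click probability `p`. -/
noncomputable def totalCost (p : unitInterval) (h : ℕ × ℕ → ℝ≥0∞) (c : ℕ × ℕ) : ℝ≥0∞ :=
  ∑' k, (clickAvg p)^[k] h c

lemma totalCost_eq (p : unitInterval) (h : ℕ × ℕ → ℝ≥0∞) (c : ℕ × ℕ) :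
    totalCost p h c = clickAvg p (totalCost p h) c + h c := by
  rw [totalCost, tsum_eq_zero_add' ENNReal.summable, add_comm]
  simp only [Function.iterate_succ_apply', Function.iterate_zero, id_eq]
  congr 1
  simp only [clickAvg, totalCost, ENNReal.tsum_add, ENNReal.tsum_mul_left]

/-- Pascal's rule, counting the orders in which the clicks can occur. -/
lemma iterate_clickAvg (p : unitInterval) (k : ℕ) (h : ℕ × ℕ → ℝ≥0∞) (c : ℕ × ℕ) :
    (clickAvg p)^[k] h c = ∑ x ∈ Finset.HasAntidiagonal.antidiagonal k, (k.choose x.1 : ℝ≥0∞) *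
      (ENNReal.ofReal p ^ x.1 * ENNReal.ofReal (1 - p) ^ x.2 * h (c.1 + x.1, c.2 + x.2)) := by
  induction k generalizing h with
  | zero => simp
  | succ k ih =>
    rw [Function.iterate_succ_apply, ih, Finset.sum_antidiagonal_choose_succ_mul (fun x y =>
      ENNReal.ofReal p ^ x * ENNReal.ofReal (1 - p) ^ y * h (c.1 + x, c.2 + y)),
      ← Finset.sum_add_distrib]
    refine Finset.sum_congr rfl fun x hx => ?_
    rw [Nat.choose_symm_of_eq_add (Finset.HasAntidiagonal.mem_antidiagonal.mp hx).symm]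
    simp only [clickAvg]
    rw [add_assoc, add_assoc]
    ring

lemma totalCost_zero (p : unitInterval) (h : ℕ × ℕ → ℝ≥0∞) :
    totalCost p h (0, 0) = ∑' k : ℕ, ∑ x ∈ Finset.range (k + 1),
      ENNReal.ofReal (binom k p x) * h (x, k - x) := by
  refine tsum_congr fun k => ?_
  rw [iterate_clickAvg, Finset.Nat.sum_antidiagonal_eq_sum_range_succ (fun x y =>
    (k.choose x : ℝ≥0∞) * (ENNReal.ofReal p ^ x * ENNReal.ofReal (1 - p) ^ y *
      h (0 + x, 0 + y)))]
  refine Finset.sum_congr rfl fun x _ => ?_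
  have h1 : (0 : ℝ) ≤ 1 - p := by linarith [p.2.2]
  rw [binom, ENNReal.ofReal_mul (by have := p.2.1; positivity),
    ENNReal.ofReal_mul (by positivity), ENNReal.ofReal_natCast,
    ENNReal.ofReal_pow p.2.1, ENNReal.ofReal_pow h1]
  simp only [zero_add, mul_assoc]

/-- The joint law of the Thompson samples and the click indicators of one round. -/
noncomputable def roundLaw (w : Fin L → unitInterval) (s : Stats L) :
    Measure ((Fin L → ℝ) × (Fin L → Bool)) := (thompsonLaw s).prod (clickLaw w)

instance (w : Fin L → unitInterval) (s : Stats L) : IsProbabilityMeasure (roundLaw w s) := by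
  unfold roundLaw; infer_instance

/-- The conditional probability that item `i` is observed, given the statistics. -/
noncomputable def obsProb (w : Fin L → unitInterval) (sel : (Fin L → ℝ) → Fin K → Fin L)
    (s : Stats L) (i : Fin L) : ℝ≥0∞ :=
  roundLaw w s {x | Observed (sel x.1) x.2 i}

lemma measurable_of_list {β : Type*} [MeasurableSpace β] {sel : (Fin L → ℝ) → Fin K → Fin L}
    (hsel : Measurable sel) (g : (Fin K → Fin L) × (Fin L → Bool) → β) :
    Measurable fun x : (Fin L → ℝ) × (Fin L → Bool) => g (sel x.1, x.2) :=
  (Measurable.of_discrete (f := g)).comp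
    ((hsel.comp measurable_fst).prodMk measurable_snd)

lemma measurableSet_observed {sel : (Fin L → ℝ) → Fin K → Fin L} (hsel : Measurable sel)
    (i : Fin L) :
    MeasurableSet {x : (Fin L → ℝ) × (Fin L → Bool) | Observed (sel x.1) x.2 i} :=
  measurableSet_setOfPred.mpr (measurable_of_list hsel fun y => Observed y.1 y.2 i)

lemma coe_toNNReal_eq_ofReal (p : unitInterval) :
    (unitInterval.toNNReal p : ℝ≥0∞) = ENNReal.ofReal p := by
  rw [ENNReal.ofReal, Real.toNNReal_of_nonneg p.2.1]
  rfl

open Classical in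
lemma lintegral_clickLaw_update (w : Fin L → unitInterval) (s : Stats L) {S : Fin K → Fin L}
    (hS : Function.Injective S) (i : Fin L) (g : ℕ × ℕ → ℝ≥0∞) :
    ∫⁻ W, g (update s S W i) ∂clickLaw w =
      ∫⁻ W, (if Observed S W i then clickAvg (w i) g (s i) else g (s i)) ∂clickLaw w := by
  rw [clickLaw, lintegral_pi_update _ Measurable.of_discrete i]
  refine lintegral_congr fun W => ?_
  simp only [update, observed_update_iff hS, Function.update_self]
  split_ifs with h
  · rw [bernoulliMeasure_def, lintegral_add_measure, lintegral_smul_measure,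
      lintegral_smul_measure, lintegral_dirac, lintegral_dirac, clickAvg]
    simp only [ENNReal.smul_def, smul_eq_mul, if_true, Bool.false_eq_true, if_false,
      coe_toNNReal_eq_ofReal, unitInterval.coe_symm_eq]
  · simp

lemma lintegral_step {w : Fin L → unitInterval} {sel : (Fin L → ℝ) → Fin K → Fin L}
    (hsel : Measurable sel) (s : Stats L) (g : Stats L → ℝ≥0∞) :
    ∫⁻ s', g s' ∂step w sel s = ∫⁻ x, g (update s (sel x.1) x.2) ∂roundLaw w s := by
  rw [step, lintegral_map Measurable.of_discrete
    (measurable_of_list hsel fun y => update s y.1 y.2)]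
  rfl

/-- By `totalCost_eq`, an observation lowers the expected potential by exactly `h (s i)`; otherwise
nothing changes. The additive form avoids subtraction of possibly infinite quantities. -/
lemma lintegral_step_totalCost {w : Fin L → unitInterval} {sel : (Fin L → ℝ) → Fin K → Fin L}
    (hsel : Measurable sel) (hg : IsGreedySelection sel) (s : Stats L) (i : Fin L)
    (h : ℕ × ℕ → ℝ≥0∞) :
    ∫⁻ s', totalCost (w i) h (s' i) ∂step w sel s + obsProb w sel s i * h (s i) =
      totalCost (w i) h (s i) := by
  classical
  rw [lintegral_step hsel s fun s' => totalCost (w i) h (s' i), roundLaw,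
    lintegral_prod _ (measurable_of_list hsel
      fun y => totalCost (w i) h (update s y.1 y.2 i)).aemeasurable]
  simp only [lintegral_clickLaw_update w s (hg.injective _)]
  rw [← lintegral_prod _ (measurable_of_list hsel fun y => if Observed y.1 y.2 i then
    clickAvg (w i) (totalCost (w i) h) (s i) else totalCost (w i) h (s i)).aemeasurable,
    mul_comm, obsProb, roundLaw, ← lintegral_indicator_const (measurableSet_observed hsel i),
    ← lintegral_add_left (measurable_of_list hsel fun y => if Observed y.1 y.2 i then
    clickAvg (w i) (totalCost (w i) h) (s i) else totalCost (w i) h (s i))]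
  rw [lintegral_congr (g := fun _ => totalCost (w i) h (s i))]
  · simp
  · intro x
    by_cases hx : Observed (sel x.1) x.2 i
    · simp [Set.indicator, hx, ← totalCost_eq]
    · simp [Set.indicator, hx]

instance isProbabilityMeasure_step {w : Fin L → unitInterval}
    {sel : (Fin L → ℝ) → Fin K → Fin L} [hsel : Fact (Measurable sel)] (s : Stats L) :
    IsProbabilityMeasure (step w sel s) :=
  Measure.isProbabilityMeasure_map
    (measurable_of_list hsel.out fun y => update s y.1 y.2).aemeasurable

lemma isProbabilityMeasure_statsLaw (w : Fin L → unitInterval)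
    {sel : (Fin L → ℝ) → Fin K → Fin L} (hsel : Measurable sel) (t : ℕ) :
    IsProbabilityMeasure (statsLaw w sel t) := by
  have := Fact.mk hsel
  induction t with
  | zero => unfold statsLaw; infer_instance
  | succ t ih =>
    refine ⟨?_⟩
    rw [statsLaw, Measure.bind_apply .univ Measurable.of_discrete.aemeasurable]
    simp

lemma lintegral_statsLaw_succ (w : Fin L → unitInterval) (sel : (Fin L → ℝ) → Fin K → Fin L)
    (t : ℕ) (g : Stats L → ℝ≥0∞) :
    ∫⁻ s, g s ∂statsLaw w sel (t + 1) = ∫⁻ s, ∫⁻ s', g s' ∂step w sel s ∂statsLaw w sel t := by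
  rw [statsLaw, Measure.lintegral_bind Measurable.of_discrete.aemeasurable
    Measurable.of_discrete.aemeasurable]

/-- The expected sum of `h` over the observations of item `i` in the first `T` rounds is at most
its expected sum over infinitely many observations. -/
lemma sum_lintegral_obsProb_le {w : Fin L → unitInterval} {sel : (Fin L → ℝ) → Fin K → Fin L}
    (hsel : Measurable sel) (hg : IsGreedySelection sel) (i : Fin L) (h : ℕ × ℕ → ℝ≥0∞) (T : ℕ) :
    ∑ t ∈ Finset.range T, ∫⁻ s, obsProb w sel s i * h (s i) ∂statsLaw w sel t ≤
      ∑' k : ℕ, ∑ x ∈ Finset.range (k + 1), ENNReal.ofReal (binom k (w i) x) * h (x, k - x) := by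
  rw [← totalCost_zero]
  suffices hT : ∫⁻ s, totalCost (w i) h (s i) ∂statsLaw w sel T +
      ∑ t ∈ Finset.range T, ∫⁻ s, obsProb w sel s i * h (s i) ∂statsLaw w sel t =
      totalCost (w i) h (0, 0) from hT ▸ le_add_self
  induction T with
  | zero => simp [statsLaw]
  | succ T ih =>
    rw [Finset.sum_range_succ, add_comm (Finset.sum _ _), ← add_assoc, ← ih]
    congr 1
    rw [lintegral_statsLaw_succ, ← lintegral_add_left Measurable.of_discrete]
    exact lintegral_congr fun s => lintegral_step_totalCost hsel hg s i h

/-! ### Missed optimal items -/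

/-- If an item of score at most `y` is observed, then raising the score of another item `j` above
`y` makes `j` observed. -/
lemma IsGreedySelection.observed_of_raise {sel : (Fin L → ℝ) → Fin K → Fin L}
    (hg : IsGreedySelection sel) {θ θ' : Fin L → ℝ} {W : Fin L → Bool} {i j : Fin L} {y : ℝ}
    -- The scores `θ` and `θ'` may differ at `j` only, so that this covers a resampling of one
    -- coordinate.
    (hθ : ∀ l, l ≠ j → θ' l = θ l) (hy : y < θ' j) (hi : Observed (sel θ) W i)
    (hiy : θ i ≤ y) : Observed (sel θ') W j := by
  obtain ⟨k, rfl, hW⟩ := hi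
  have h1 : ∀ l, y < θ l → ∃ m < k, sel θ m = l := by
    intro l hl
    by_contra! hcon
    have := (hg θ k).2 l fun m hm => (hcon m hm).symm
    linarith
  have h2 : ∀ m, (∀ m' < m, sel θ' m' ≠ j) → sel θ' m ≠ j → y < θ (sel θ' m) := by
    intro m hm hne
    have := (hg θ' m).2 j fun m' hm' => (hm m' hm').symm
    rw [← hθ _ hne]
    linarith
  -- If `j` were not taken, all `K` items of the new list would come from the slots before `k` of
  -- the old one, which are fewer than `K`.
  have h3 : ∃ k', sel θ' k' = j := by
    by_contra! hcon
    choose f hf1 hf2 using fun m => h1 _ (h2 m (fun m' _ => hcon m') (hcon m))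
    have hinj : Function.Injective f := fun a b hab =>
      hg.injective θ' (by rw [← hf2 a, ← hf2 b, hab])
    obtain ⟨m, hm⟩ := Finite.surjective_of_injective hinj k
    exact (hf1 m).ne hm
  obtain ⟨k', hk'⟩ := h3
  refine ⟨k', hk', fun m hm => ?_⟩
  have hne : ∀ m < k', sel θ' m ≠ j := fun m hm => by
    rw [← hk']; exact fun h => hm.ne (hg.injective θ' h)
  obtain ⟨m', hm', he⟩ := h1 _ (h2 m (fun m' hm' => hne m' (hm'.trans hm)) (hne m hm))
  rw [← he]
  exact hW m' hm'

/-- Item `j` is not listed, although an item of score at most `y` is observed. -/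
def Missed (sel : (Fin L → ℝ) → Fin K → Fin L) (j : Fin L) (y : ℝ)
    (x : (Fin L → ℝ) × (Fin L → Bool)) : Prop :=
  (∀ k, sel x.1 k ≠ j) ∧ ∃ i, Observed (sel x.1) x.2 i ∧ x.1 i ≤ y

lemma measurableSet_missed {sel : (Fin L → ℝ) → Fin K → Fin L} (hsel : Measurable sel)
    (j : Fin L) (y : ℝ) : MeasurableSet {x | Missed sel j y x} := by
  have h1 : MeasurableSet {x : (Fin L → ℝ) × (Fin L → Bool) | ∀ k, sel x.1 k ≠ j} :=
    measurableSet_setOfPred.mpr (measurable_of_list hsel fun z => ∀ k, z.1 k ≠ j)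
  have h2 : MeasurableSet
      (⋃ i, {x : (Fin L → ℝ) × (Fin L → Bool) | Observed (sel x.1) x.2 i} ∩ {x | x.1 i ≤ y}) :=
    MeasurableSet.iUnion fun i => (measurableSet_observed hsel i).inter
      (measurableSet_le ((measurable_pi_apply i).comp measurable_fst) measurable_const)
  convert! h1.inter h2 using 1
  ext x
  simp [Missed]

/-- Fix the clicks and all samples but that of `j`. A miss forces the sample of `j` to be at most
`y`; and if a miss is possible at all, every sample of `j` above `y` makes `j` observed. Multiplying
the two resulting conditional inequalities crosswise and integrating gives the claim. -/
lemma mul_roundLaw_missed_le {w : Fin L → unitInterval} {sel : (Fin L → ℝ) → Fin K → Fin L}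
    (hsel : Measurable sel) (hg : IsGreedySelection sel) (s : Stats L) (j : Fin L) (y : ℝ) :
    betaMeasure (betaAlpha s j) (betaBeta s j) (Set.Ioi y) * roundLaw w s {x | Missed sel j y x} ≤
      betaMeasure (betaAlpha s j) (betaBeta s j) (Set.Iic y) * obsProb w sel s j := by
  classical
  set μ : Fin L → Measure ℝ := fun i => betaMeasure (betaAlpha s i) (betaBeta s i) with hμ
  have hD := measurableSet_missed hsel j y
  have hO := measurableSet_observed hsel j
  have key : ∀ A : Set ((Fin L → ℝ) × (Fin L → Bool)), MeasurableSet A →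
      roundLaw w s A = ∫⁻ W, ∫⁻ θ, ∫⁻ u, A.indicator 1 (Function.update θ j u, W) ∂μ j
        ∂Measure.pi μ ∂clickLaw w := by
    intro A hA
    rw [← lintegral_indicator_one hA, roundLaw, lintegral_prod_symm _
      (measurable_one.indicator hA).aemeasurable]
    refine lintegral_congr fun W => ?_
    exact lintegral_pi_update μ
      (f := fun θ => A.indicator 1 (θ, W)) ((measurable_one.indicator hA).comp
        (measurable_id.prodMk measurable_const)) j
  rw [obsProb, key _ hD, key _ hO, ← lintegral_const_mul' _ _ (measure_ne_top _ _),
    ← lintegral_const_mul' _ _ (measure_ne_top _ _)]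
  refine lintegral_mono fun W => ?_
  rw [← lintegral_const_mul' _ _ (measure_ne_top _ _),
    ← lintegral_const_mul' _ _ (measure_ne_top _ _)]
  refine lintegral_mono fun θ => ?_
  by_cases hex : ∃ u, Missed sel j y (Function.update θ j u, W)
  · obtain ⟨u, hu1, i, hi, hiy⟩ := hex
    have h1 : ∫⁻ u, {x | Missed sel j y x}.indicator
        (1 : (Fin L → ℝ) × (Fin L → Bool) → ℝ≥0∞) (Function.update θ j u, W) ∂μ j ≤ μ j (Set.Iic y) := by
      rw [← lintegral_indicator_one measurableSet_Iic]
      refine lintegral_mono fun v => ?_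
      by_cases hv : Missed sel j y (Function.update θ j v, W)
      · obtain ⟨hv1, i', hi', hiy'⟩ := hv
        have hvy : v ≤ y := by
          obtain ⟨k, hk, _⟩ := hi'
          have := (hg (Function.update θ j v) k).2 j fun m _ => (hv1 m).symm
          rw [hk, Function.update_self] at this
          exact this.trans hiy'
        rw [Set.indicator_of_mem (show v ∈ Set.Iic y from hvy)]
        exact Set.indicator_le_self' (fun _ _ => zero_le) _
      · rw [Set.indicator_of_notMem (by exact hv)]
        exact zero_le
    have h2 : μ j (Set.Ioi y) ≤ ∫⁻ u, {x : (Fin L → ℝ) × (Fin L → Bool) |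
        Observed (sel x.1) x.2 j}.indicator
          (1 : (Fin L → ℝ) × (Fin L → Bool) → ℝ≥0∞) (Function.update θ j u, W) ∂μ j := by
      rw [← lintegral_indicator_one measurableSet_Ioi]
      refine lintegral_mono fun v => ?_
      by_cases hv : y < v
      · have : Observed (sel (Function.update θ j v)) W j :=
          hg.observed_of_raise (θ := Function.update θ j u) (y := y)
            (fun l hl => by simp [Function.update_of_ne hl]) (by simpa using hv) hi hiy
        rw [Set.indicator_of_mem (show v ∈ Set.Ioi y from hv), Set.indicator_of_mem (by exact this)]
        rfl
      · rw [Set.indicator_of_notMem (by exact hv)]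
        exact zero_le
    rw [mul_comm]
    exact mul_le_mul' h1 h2
  · have h0 : ∀ u, {x | Missed sel j y x}.indicator
        (1 : (Fin L → ℝ) × (Fin L → Bool) → ℝ≥0∞) (Function.update θ j u, W) = 0 :=
      fun u => Set.indicator_of_notMem (s := {x | Missed sel j y x}) (fun h => hex ⟨u, h⟩) _
    simp [h0]

/-- The probability that item `j` is missed is at most its posterior odds times the probability
that it is observed. -/
lemma roundLaw_missed_le {w : Fin L → unitInterval} {sel : (Fin L → ℝ) → Fin K → Fin L}
    (hsel : Measurable sel) (hg : IsGreedySelection sel) (s : Stats L) (j : Fin L) {y : ℝ}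
    (h0 : 0 ≤ y) (h1 : y < 1) :
    roundLaw w s {x | Missed sel j y x} ≤ obsProb w sel s j *
      ENNReal.ofReal (1 / binomCdf ((s j).1 + (s j).2 + 1) y (s j).1 - 1) := by
  have h := mul_roundLaw_missed_le (w := w) hsel hg s j y
  set F := binomCdf ((s j).1 + (s j).2 + 1) y (s j).1 with hF
  have hFpos : 0 < F := binomCdf_pos h0 h1
  have hI : betaMeasure (betaAlpha s j) (betaBeta s j) (Set.Ioi y) = ENNReal.ofReal F :=
    betaMeasure_Ioi h0 h1.le
  have hC : betaMeasure (betaAlpha s j) (betaBeta s j) (Set.Iic y) = ENNReal.ofReal (1 - F) := by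
    rw [← Set.compl_Ioi, prob_compl_eq_one_sub measurableSet_Ioi, hI,
      ENNReal.ofReal_sub _ hFpos.le, ENNReal.ofReal_one]
  rw [hI, hC] at h
  have e : ENNReal.ofReal F * ENNReal.ofReal (1 / F - 1) = ENNReal.ofReal (1 - F) := by
    rw [← ENNReal.ofReal_mul hFpos.le]
    congr 1
    field_simp
  rw [← e, mul_assoc] at h
  rw [mul_comm]
  exact (ENNReal.mul_le_mul_iff_right (by simpa using hFpos) ENNReal.ofReal_ne_top).mp h

/-! ### Decomposition of the loss of a list -/

lemma clickLaw_observed (w : Fin L → unitInterval) {S : Fin K → Fin L}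
    (hS : Function.Injective S) (k : Fin K) :
    clickLaw w {W | Observed S W (S k)} =
      ENNReal.ofReal (∏ m with m < k, (1 - (w (S m) : ℝ))) := by
  classical
  have e : {W : Fin L → Bool | Observed S W (S k)} =
      Set.univ.pi fun l => if l ∈ (Finset.univ.filter (· < k)).image S then {false} else Set.univ := by
    ext W
    simp only [Set.mem_ofPred_eq, Set.mem_pi, Set.mem_univ, true_imp_iff]
    constructor
    · rintro ⟨k', hk', h⟩ l
      obtain rfl := hS hk'
      split_ifs with hl
      · obtain ⟨m, hm, rfl⟩ := Finset.mem_image.mp hl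
        exact h m (Finset.mem_filter.mp hm).2
      · trivial
    · intro h
      refine ⟨k, rfl, fun m hm => ?_⟩
      have := h (S m)
      rw [if_pos (Finset.mem_image_of_mem S (by simpa using hm))] at this
      exact this
  rw [e, clickLaw, Measure.pi_pi, ENNReal.ofReal_prod_of_nonneg
    (fun m _ => by linarith [(w (S m)).2.2])]
  have h : ∀ l, bernoulliMeasure true false (w l)
      (if l ∈ (Finset.univ.filter (· < k)).image S then {false} else Set.univ) =
      if l ∈ (Finset.univ.filter (· < k)).image S then ENNReal.ofReal (1 - w l) else 1 := by
    intro l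
    split_ifs
    · rw [bernoulliMeasure_apply_of_notMem_of_mem _ (by simp) (by simp) (by simp),
        coe_toNNReal_eq_ofReal, unitInterval.coe_symm_eq]
    · simp
  simp only [h]
  rw [Finset.prod_ite_mem, Finset.univ_inter, Finset.prod_image fun a _ b _ h => hS h]

lemma optimalItems_eq_map (hKL : K ≤ L) :
    optimalItems L K = Finset.univ.map (Fin.castLEEmb hKL) := by
  ext j
  simp only [optimalItems, Finset.mem_filter, Finset.mem_univ, true_and, Finset.mem_map]
  exact ⟨fun h => ⟨⟨j, h⟩, rfl⟩, by rintro ⟨k, rfl⟩; exact k.2⟩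

/-- The loss of reward of a list is at most the expected sum of the gaps between its observed
suboptimal items and optimal items not in the list that are matched with them. -/
lemma exists_matching (hKL : K ≤ L) {w : Fin L → unitInterval} (hw : Antitone w)
    {S : Fin K → Fin L} (hS : Function.Injective S) :
    ∃ π : Fin K → Fin L, Function.Injective π ∧ (∀ k, (π k : ℕ) < K) ∧
      (∀ k, K ≤ (S k : ℕ) → ∀ k', S k' ≠ π k) ∧
      expectedReward w (firstItems hKL) - expectedReward w S ≤
        ∑ k with K ≤ (S k : ℕ), (∏ m with m < k, (1 - (w (S m) : ℝ))) * gap w (π k) (S k) := by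
  classical
  have hcard : Fintype.card (Fin K) = (optimalItems L K).card := by
    rw [optimalItems_eq_map hKL, Finset.card_map, Finset.card_univ]
  -- `g` fixes the optimal items already listed, so the other slots receive precisely the optimal
  -- items that are missing.
  obtain ⟨g, hgS⟩ := Set.MapsTo.exists_equiv_extend_of_card_eq hcard
    (s := {k | (S k : ℕ) < K}) (f := S) (fun k hk => by simpa [optimalItems] using hk) hS.injOn
  have hlt : ∀ k, ((g k : Fin L) : ℕ) < K := fun k => by
    have := (g k).2
    exact (Finset.mem_filter.mp this).2
  have hgi : Function.Injective fun k => (g k : Fin L) :=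
    Subtype.val_injective.comp g.injective
  refine ⟨fun k => g k, hgi, hlt, ?_, ?_⟩
  · intro k hk k' h
    have hk' : (S k' : ℕ) < K := by rw [h]; exact hlt k
    have h2 : (g k' : Fin L) = g k := by rw [hgS k' hk', h]
    have h3 := hgi h2
    rw [h3] at hk'
    omega
  · have hprod : ∏ k, (1 - (w (firstItems hKL k) : ℝ)) = ∏ k, (1 - (w (g k) : ℝ)) := by
      rw [← Equiv.prod_comp g.symm (fun k => 1 - (w (g k) : ℝ))]
      simp only [Equiv.apply_symm_apply]
      have : ∏ k, (1 - (w (firstItems hKL k) : ℝ)) = ∏ j ∈ optimalItems L K, (1 - (w j : ℝ)) := by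
        rw [optimalItems_eq_map hKL, Finset.prod_map]
        rfl
      rw [this, Finset.univ_eq_attach, Finset.prod_attach (optimalItems L K) (fun j => 1 - (w j : ℝ))]
    have h01 : ∀ l, 0 ≤ 1 - (w l : ℝ) ∧ 1 - (w l : ℝ) ≤ 1 := fun l =>
      ⟨by linarith [(w l).2.2], by linarith [(w l).2.1]⟩
    -- Replaces the factors one by one: listed items before `k`, the gap at `k`, matched optimal
    -- items after `k`. The last product is at most `1` and is dropped later.
    have htel := Finset.prod_add_ordered Finset.univ (fun k => 1 - (w (g k) : ℝ))
      (fun k => gap w (g k) (S k))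
    have hsum : ∀ k, 1 - (w (g k) : ℝ) + gap w (g k) (S k) = 1 - w (S k) := fun k => by
      unfold gap; ring
    simp only [hsum] at htel
    have hdiff : expectedReward w (firstItems hKL) - expectedReward w S =
        ∑ k, gap w (g k) (S k) * (∏ m with m < k, (1 - (w (S m) : ℝ))) *
          ∏ m with k < m, (1 - (w (g m) : ℝ)) := by
      unfold expectedReward
      rw [hprod, htel]; ring
    rw [hdiff, Finset.sum_filter]
    refine Finset.sum_le_sum fun k _ => ?_
    split_ifs with hk
    · have hgap : 0 ≤ gap w (g k) (S k) := by
        have : w (S k) ≤ w (g k) := hw (Fin.le_def.mpr ((hlt k).le.trans hk))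
        unfold gap
        exact sub_nonneg.mpr this
      rw [mul_comm (gap _ _ _)]
      exact mul_le_of_le_one_right
        (mul_nonneg (Finset.prod_nonneg fun m _ => (h01 _).1) hgap)
        (Finset.prod_le_one (fun m _ => (h01 _).1) fun m _ => (h01 _).2)
    · have : (g k : Fin L) = S k := hgS k (not_le.mp hk)
      simp [gap, this]

/-! ### Costs summed over the observations of one item -/

lemma tsum_le_ofReal {f : ℕ → ℝ≥0∞} {g : ℕ → ℝ} {B : ℝ} (hg : ∀ k, 0 ≤ g k)
    (hfg : ∀ k, f k ≤ ENNReal.ofReal (g k)) (hB : HasSum g B) : ∑' k, f k ≤ ENNReal.ofReal B := by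
  rw [← hB.tsum_eq, ENNReal.ofReal_tsum_of_nonneg hg hB.summable]
  exact ENNReal.tsum_le_tsum hfg

/-- The cost `1` of an observation at which the empirical mean exceeds the true mean `p` by more
than `ε`. -/
noncomputable def deviationCost (p ε : ℝ) (c : ℕ × ℕ) : ℝ≥0∞ :=
  if (p + ε) * ((c.1 + c.2 : ℕ) : ℝ) < c.1 then 1 else 0

lemma tsum_deviationCost_le {p ε : ℝ} (h0 : 0 ≤ p) (h1 : p ≤ 1) (hε : 0 < ε) :
    ∑' k : ℕ, ∑ x ∈ Finset.range (k + 1),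
      ENNReal.ofReal (binom k p x) * deviationCost p ε (x, k - x) ≤
        ENNReal.ofReal (1 + 1 / ε ^ 2) := by
  have hε2 : 0 < 2 * ε ^ 2 := by positivity
  have hlt : Real.exp (-(2 * ε ^ 2)) < 1 := by
    rw [Real.exp_lt_one_iff]; linarith
  refine (tsum_le_ofReal (fun k => ?_) (fun k => ?_)
    (hasSum_geometric_of_lt_one (Real.exp_pos _).le hlt)).trans (ENNReal.ofReal_le_ofReal ?_)
  · positivity
  · have h := binom_upper_tail_le (n := k) h0 h1 hε.le
    rw [show Real.exp (-(2 * k * ε ^ 2)) = Real.exp (-(2 * ε ^ 2)) ^ k by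
      rw [← Real.exp_nat_mul]; ring_nf] at h
    refine le_trans (le_of_eq ?_) (ENNReal.ofReal_le_ofReal h)
    rw [ENNReal.ofReal_sum_of_nonneg fun b _ => by
      have := binom_nonneg h0 h1 (n := k) b
      positivity]
    refine Finset.sum_congr rfl fun x hx => ?_
    have hxk : x + (k - x) = k := by have := Finset.mem_range.mp hx; omega
    simp only [deviationCost, hxk]
    split_ifs <;> simp
  · have h2 : 1 + 2 * ε ^ 2 ≤ Real.exp (2 * ε ^ 2) := by
      linarith [Real.add_one_le_exp (2 * ε ^ 2)]
    have h3 : Real.exp (-(2 * ε ^ 2)) ≤ (1 + 2 * ε ^ 2)⁻¹ := by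
      rw [Real.exp_neg]; exact inv_anti₀ (by positivity) h2
    have h4 : 1 - (1 + 2 * ε ^ 2)⁻¹ = 2 * ε ^ 2 / (1 + 2 * ε ^ 2) := by field_simp; ring
    have h5 : 0 < 2 * ε ^ 2 / (1 + 2 * ε ^ 2) := by positivity
    calc (1 - Real.exp (-(2 * ε ^ 2)))⁻¹ ≤ (2 * ε ^ 2 / (1 + 2 * ε ^ 2))⁻¹ :=
          inv_anti₀ h5 (by linarith)
      _ = 1 + 1 / ε ^ 2 / 2 := by field_simp; ring
      _ ≤ _ := by
        have : 0 < 1 / ε ^ 2 := by positivity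
        linarith

/-- A bound of the gaps that are still to be explored after `n` observations, when exploration at
gap `d` is over after `l / d ^ 2` observations. -/
noncomputable def exploration (l d ε : ℝ) (n : ℕ) : ℝ :=
  if n = 0 then (if 0 < l then 1 else 0)
  else if n * d ^ 2 < l then Real.sqrt (l / n) + 2 * ε else 0

lemma exploration_nonneg {l d ε : ℝ} (hε : 0 ≤ ε) (n : ℕ) : 0 ≤ exploration l d ε n := by
  unfold exploration
  split_ifs <;> positivity

/-- An unfinished exploration at gap `d'` has `d' ≤ √(l / n)`. This bound no longer involves `d'`,
so one cost per observation of `i` serves every optimal item matched with it, and only the smallest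
gap `d` enters the sum. -/
lemma le_exploration {l d d' ε : ℝ} {n : ℕ} (hd : 0 ≤ d) (hdd' : d ≤ d')
    (hd1 : d' + 2 * ε ≤ 1) (hn : n * d' ^ 2 < l) : d' + 2 * ε ≤ exploration l d ε n := by
  unfold exploration
  split_ifs with h0 h1 h2
  · exact hd1
  · rw [h0] at hn; simp at hn; exact absurd hn h1
  · have hn0 : (0 : ℝ) < n := by positivity
    have : d' ≤ Real.sqrt (l / n) := by
      refine Real.le_sqrt_of_sq_le ?_
      rw [le_div_iff₀ hn0]; linarith
    linarith
  · have : (n : ℝ) * d ^ 2 ≤ n * d' ^ 2 := by gcongr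
    linarith

/-- Comparison with an integral: `1 / √(n + 1) ≤ 2 * (√(n + 1) - √n)`. The minimum lets the
induction continue past `l / d ^ 2`, where the terms vanish. -/
lemma sum_exploration_le {l d ε : ℝ} (hl : 0 ≤ l) (hd : 0 < d) (hε : 0 ≤ ε) (n : ℕ) :
    ∑ k ∈ Finset.range (n + 1), exploration l d ε k ≤
      (if 0 < l then 1 else 0) + 2 * Real.sqrt (l * min (n : ℝ) (l / d ^ 2))
        + 2 * ε * min (n : ℝ) (l / d ^ 2) := by
  induction n with
  | zero =>
    have : 0 ≤ l / d ^ 2 := by positivity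
    simp [exploration, this]
  | succ n ih =>
    rw [Finset.sum_range_succ]
    have hmin : min (n : ℝ) (l / d ^ 2) ≤ min ((n + 1 : ℕ) : ℝ) (l / d ^ 2) :=
      min_le_min_right _ (by push_cast; linarith)
    by_cases hc : ((n + 1 : ℕ) : ℝ) * d ^ 2 < l
    · have h1 : ((n + 1 : ℕ) : ℝ) ≤ l / d ^ 2 := by
        rw [le_div_iff₀ (by positivity)]; exact hc.le
      have h2 : (n : ℝ) ≤ l / d ^ 2 := by push_cast at h1; linarith
      rw [min_eq_left h1]
      rw [min_eq_left h2] at ih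
      have e : exploration l d ε (n + 1) = Real.sqrt (l / (n + 1 : ℕ)) + 2 * ε := by
        rw [exploration, if_neg (Nat.succ_ne_zero n), if_pos hc]
      have h3 : Real.sqrt (l / (n + 1 : ℕ)) ≤
          2 * Real.sqrt (l * (n + 1 : ℕ)) - 2 * Real.sqrt (l * n) := by
        rw [Real.sqrt_div hl, Real.sqrt_mul hl, Real.sqrt_mul hl, div_le_iff₀ (by positivity)]
        have s1 := Real.sq_sqrt (show (0 : ℝ) ≤ (n + 1 : ℕ) by positivity)
        have s2 := Real.sq_sqrt (show (0 : ℝ) ≤ n by positivity)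
        have hL := Real.sqrt_nonneg l
        push_cast at s1 ⊢
        have key : 1 ≤ (2 * Real.sqrt ((n : ℝ) + 1) - 2 * Real.sqrt n) * Real.sqrt (n + 1) := by
          nlinarith [sq_nonneg (Real.sqrt ((n : ℝ) + 1) - Real.sqrt n)]
        nlinarith
      rw [e]
      push_cast at h3 ih ⊢
      linarith
    · have e : exploration l d ε (n + 1) = 0 := by
        rw [exploration, if_neg (Nat.succ_ne_zero n), if_neg hc]
      rw [e, add_zero]
      have h1 := Real.sqrt_le_sqrt (mul_le_mul_of_nonneg_left hmin hl)
      have h2 := mul_le_mul_of_nonneg_left hmin (show 0 ≤ 2 * ε by positivity)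
      linarith

lemma sum_exploration_log_le {d ε : ℝ} {T : ℕ} (hd : 0 < d) (hd1 : d ≤ 1) (hε : 0 ≤ ε) (n : ℕ) :
    ∑ k ∈ Finset.range n, exploration (Real.log T) d ε k ≤
      4 * Real.log T * ((d + ε) / d ^ 2) := by
  have hl : 0 ≤ Real.log T := Real.log_natCast_nonneg T
  set l := Real.log T with hl_def
  calc _ ≤ ∑ k ∈ Finset.range (n + 1), exploration l d ε k :=
        Finset.sum_le_sum_of_subset_of_nonneg (Finset.range_mono (Nat.le_succ n))
          fun k _ _ => exploration_nonneg hε k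
    _ ≤ _ := sum_exploration_le hl hd hε n
    _ ≤ 2 * (l / d) + 2 * Real.sqrt (l * (l / d ^ 2)) + 2 * ε * (l / d ^ 2) := by
        gcongr
        · split_ifs with h
          -- The unit cost of the first observation is paid only if `log T > 0`; then `T ≥ 2` and `1
          -- ≤ 2 * log 2 ≤ 2 * (l / d)`.
          · have hT : 2 ≤ T := by
              by_contra! hT
              have : T = 0 ∨ T = 1 := by omega
              rcases this with rfl | rfl <;> simp [hl_def] at h
            have h2 : Real.log 2 ≤ l := Real.log_le_log (by norm_num) (by exact_mod_cast hT)
            have h3 : l ≤ l / d := le_div_self hl hd hd1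
            linarith [Real.log_two_gt_d9]
          · positivity
        · exact min_le_right _ _
        · exact min_le_right _ _
    _ = 4 * (l / d) + 2 * ε * (l / d ^ 2) := by
        rw [show l * (l / d ^ 2) = (l / d) ^ 2 by ring, Real.sqrt_sq (by positivity)]
        ring
    _ ≤ 4 * (l / d) + 4 * ε * (l / d ^ 2) := by gcongr; norm_num
    _ = _ := by field_simp

lemma tsum_exploration_le {p : ℝ} (h0 : 0 ≤ p) (h1 : p ≤ 1) {d ε : ℝ} {T : ℕ} (hd : 0 < d)
    (hd1 : d ≤ 1) (hε : 0 ≤ ε) :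
    ∑' k : ℕ, ∑ x ∈ Finset.range (k + 1), ENNReal.ofReal (binom k p x) *
        ENNReal.ofReal (exploration (Real.log T) d ε (x + (k - x))) ≤
      ENNReal.ofReal (4 * Real.log T * ((d + ε) / d ^ 2)) := by
  have e : ∀ k : ℕ, ∑ x ∈ Finset.range (k + 1), ENNReal.ofReal (binom k p x) *
      ENNReal.ofReal (exploration (Real.log T) d ε (x + (k - x))) =
      ENNReal.ofReal (exploration (Real.log T) d ε k) := by
    intro k
    have : ∀ x ∈ Finset.range (k + 1), ENNReal.ofReal (binom k p x) *
        ENNReal.ofReal (exploration (Real.log T) d ε (x + (k - x))) =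
        ENNReal.ofReal (binom k p x) * ENNReal.ofReal (exploration (Real.log T) d ε k) := by
      intro x hx
      rw [show x + (k - x) = k by have := Finset.mem_range.mp hx; omega]
    rw [Finset.sum_congr rfl this, ← Finset.sum_mul, ← ENNReal.ofReal_sum_of_nonneg
      fun b _ => binom_nonneg h0 h1 b, sum_binom, ENNReal.ofReal_one, one_mul]
  simp only [e]
  rw [ENNReal.tsum_eq_iSup_nat]
  refine iSup_le fun n => ?_
  rw [← ENNReal.ofReal_sum_of_nonneg fun k _ => exploration_nonneg hε k]
  exact ENNReal.ofReal_le_ofReal (sum_exploration_log_le hd hd1 hε n)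

lemma tsum_odds_le {p ε : ℝ} (hε : 0 < ε) (hp : ε < p) (h1 : p ≤ 1) :
    ∑' k : ℕ, ∑ x ∈ Finset.range (k + 1), ENNReal.ofReal (binom k p x) *
        ENNReal.ofReal (1 / binomCdf (x + (k - x) + 1) (p - ε) x - 1) ≤
      ENNReal.ofReal ((4 + 20 * Real.exp 2) / ε ^ 4) := by
  obtain ⟨B, hB, hsum⟩ := hasSum_odds_bound (e := ε) (by linarith) hε
  refine (tsum_le_ofReal (fun k => by positivity) (fun k => ?_) hsum).trans
    (ENNReal.ofReal_le_ofReal hB)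
  have h := sum_binom_mul_odds_le (n := k) (y := p - ε) (by linarith) hε (by linarith)
  rw [sub_add_cancel] at h
  refine le_trans (le_of_eq ?_) (ENNReal.ofReal_le_ofReal h)
  rw [ENNReal.ofReal_sum_of_nonneg fun x hx => ?_]
  · refine Finset.sum_congr rfl fun x hx => ?_
    rw [show x + (k - x) = k by have := Finset.mem_range.mp hx; omega,
      ENNReal.ofReal_mul (binom_nonneg (by linarith) h1 x)]
  · refine mul_nonneg (binom_nonneg (by linarith) h1 x) (sub_nonneg.mpr ?_)
    rw [le_div_iff₀ (binomCdf_pos (by linarith) (by linarith)), one_mul]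
    exact binomCdf_le_one (by linarith) (by linarith) (by have := Finset.mem_range.mp hx; omega)

/-! ### Charging the loss of one round -/

/-- The total number of observations of item `i`. -/
def obsCount (s : Stats L) (i : Fin L) : ℕ := (s i).1 + (s i).2

/-- The sample of item `i` exceeds `w j - ε`, although item `i` has been observed often enough and
its empirical mean does not exceed its true mean by more than `ε`. -/
def Deceived (w : Fin L → unitInterval) (l ε : ℝ) (s : Stats L) (i j : Fin L)
    (x : (Fin L → ℝ) × (Fin L → Bool)) : Prop :=
  (l ≤ obsCount s i * (gap w j i - 2 * ε) ^ 2 ∧ ((s i).1 : ℝ) ≤ ((w i : ℝ) + ε) * obsCount s i) ∧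
    (w j : ℝ) - ε < x.1 i

lemma measurableSet_deceived (w : Fin L → unitInterval) (l ε : ℝ) (s : Stats L) (i j : Fin L) :
    MeasurableSet {x | Deceived w l ε s i j x} :=
  (MeasurableSet.const _).inter
    (measurableSet_lt measurable_const ((measurable_pi_apply i).comp measurable_fst))

/-- The Beta tail is a binomial lower tail at distance `gap w j i - 2 * ε` below the mean, since `w
j - ε` exceeds `w i + ε` by that much. Hoeffding's exponent is at least `2 * l`, of which half
suffices. The data conditions depend on `s` only, so if they fail the event is empty. -/
lemma roundLaw_deceived_le {w : Fin L → unitInterval} {l ε : ℝ} (s : Stats L) {i j : Fin L}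
    (hε : 0 < ε) (hgap : 0 < gap w j i - 2 * ε) :
    roundLaw w s {x | Deceived w l ε s i j x} ≤ ENNReal.ofReal (Real.exp (-l)) := by
  by_cases hc : l ≤ obsCount s i * (gap w j i - 2 * ε) ^ 2 ∧
      ((s i).1 : ℝ) ≤ ((w i : ℝ) + ε) * obsCount s i
  · have hw0 := (w i).2.1
    have hw1 := (w j).2.2
    unfold gap at hgap hc
    have h0 : 0 ≤ (w j : ℝ) - ε := by linarith
    have h1 : (w j : ℝ) - ε ≤ 1 := by linarith
    have hmp : MeasurePreserving (fun x : (Fin L → ℝ) × (Fin L → Bool) => x.1 i) (roundLaw w s)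
        (betaMeasure (betaAlpha s i : ℝ) (betaBeta s i : ℝ)) :=
      (measurePreserving_eval (fun i => betaMeasure (betaAlpha s i : ℝ) (betaBeta s i : ℝ)) i).comp
        measurePreserving_fst
    have hsub : {x | Deceived w l ε s i j x} ⊆
        (fun x : (Fin L → ℝ) × (Fin L → Bool) => x.1 i) ⁻¹' Set.Ioi ((w j : ℝ) - ε) :=
      fun x hx => hx.2
    refine (measure_mono hsub).trans ?_
    rw [hmp.measure_preimage measurableSet_Ioi.nullMeasurableSet]
    refine (betaMeasure_Ioi h0 h1).le.trans (ENNReal.ofReal_le_ofReal ?_)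
    have hN : ((obsCount s i : ℕ) : ℝ) ≤ ((s i).1 + (s i).2 + 1 : ℕ) := by
      simp [obsCount]
    refine (binomCdf_le_exp h0 h1 hgap.le ?_ (by omega)).trans (Real.exp_le_exp.mpr ?_)
    · refine hc.2.trans ?_
      rw [show (w j : ℝ) - ε - (w j - w i - 2 * ε) = w i + ε by ring]
      gcongr
    · have h3 : (obsCount s i : ℝ) * ((w j : ℝ) - w i - 2 * ε) ^ 2 ≤
          ((s i).1 + (s i).2 + 1 : ℕ) * ((w j : ℝ) - w i - 2 * ε) ^ 2 := by gcongr
      have h4 : 0 ≤ (obsCount s i : ℝ) * ((w j : ℝ) - w i - 2 * ε) ^ 2 := by positivity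
      have := hc.1
      linarith
  · have : {x | Deceived w l ε s i j x} = ∅ := by
      ext x
      simp only [Deceived, Set.mem_ofPred_eq, Set.mem_empty_iff_false, iff_false]
      exact fun h => hc h.1
    simp [this]

/-- The cost charged to an observation of item `i` with statistics `c`. -/
noncomputable def obsCost (p l d ε : ℝ) (c : ℕ × ℕ) : ℝ≥0∞ :=
  deviationCost p ε c + ENNReal.ofReal (exploration l d ε (c.1 + c.2))

/-- A bound of the loss of one round with samples and clicks `x`: costs of observed suboptimal
items, of items that are overestimated by their samples, and of missed optimal items. -/
noncomputable def lossBound (w : Fin L → unitInterval) (sel : (Fin L → ℝ) → Fin K → Fin L)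
    (l ε : ℝ) (j₀ i₀ : Fin L) (s : Stats L) (x : (Fin L → ℝ) × (Fin L → Bool)) : ℝ≥0∞ :=
  ∑ i ∈ suboptimalItems L K, {x : (Fin L → ℝ) × (Fin L → Bool) |
      Observed (sel x.1) x.2 i}.indicator
        (fun _ => obsCost (w i) l (gap w j₀ i - 2 * ε) ε (s i)) x +
    ∑ i ∈ suboptimalItems L K, ∑ j ∈ optimalItems L K,
      {x | Deceived w l ε s i j x}.indicator (fun _ => ENNReal.ofReal (gap w j i)) x +
    ∑ j ∈ optimalItems L K, {x | Missed sel j ((w j : ℝ) - ε) x}.indicator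
        (fun _ => ENNReal.ofReal (gap w j i₀)) x

lemma measurable_lossBound (w : Fin L → unitInterval) {sel : (Fin L → ℝ) → Fin K → Fin L}
    (hsel : Measurable sel) (l ε : ℝ) (j₀ i₀ : Fin L) (s : Stats L) :
    Measurable (lossBound w sel l ε j₀ i₀ s) := by
  unfold lossBound
  refine (Measurable.add ?_ ?_).add ?_
  · exact Finset.measurable_fun_sum _ fun i _ =>
      measurable_const.indicator (measurableSet_observed hsel i)
  · exact Finset.measurable_fun_sum _ fun i _ => Finset.measurable_fun_sum _ fun j _ =>
      measurable_const.indicator (measurableSet_deceived w l ε s i j)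
  · exact Finset.measurable_fun_sum _ fun j _ =>
      measurable_const.indicator (measurableSet_missed hsel j _)

lemma lintegral_lossBound (w : Fin L → unitInterval) {sel : (Fin L → ℝ) → Fin K → Fin L}
    (hsel : Measurable sel) (l ε : ℝ) (j₀ i₀ : Fin L) (s : Stats L) :
    ∫⁻ x, lossBound w sel l ε j₀ i₀ s x ∂roundLaw w s =
      ∑ i ∈ suboptimalItems L K,
        obsProb w sel s i * obsCost (w i) l (gap w j₀ i - 2 * ε) ε (s i) +
      ∑ i ∈ suboptimalItems L K, ∑ j ∈ optimalItems L K,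
        roundLaw w s {x | Deceived w l ε s i j x} * ENNReal.ofReal (gap w j i) +
      ∑ j ∈ optimalItems L K,
        roundLaw w s {x | Missed sel j ((w j : ℝ) - ε) x} * ENNReal.ofReal (gap w j i₀) := by
  have m1 : ∀ i, Measurable ({x : (Fin L → ℝ) × (Fin L → Bool) |
      Observed (sel x.1) x.2 i}.indicator
        (fun _ => obsCost (w i) l (gap w j₀ i - 2 * ε) ε (s i))) := fun i =>
    measurable_const.indicator (measurableSet_observed hsel i)
  have m2 : ∀ i j, Measurable ({x | Deceived w l ε s i j x}.indicator
      (fun _ => ENNReal.ofReal (gap w j i))) := fun i j =>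
    measurable_const.indicator (measurableSet_deceived w l ε s i j)
  have m3 : ∀ j, Measurable ({x | Missed sel j ((w j : ℝ) - ε) x}.indicator
      (fun _ => ENNReal.ofReal (gap w j i₀))) := fun j =>
    measurable_const.indicator (measurableSet_missed hsel j _)
  unfold lossBound
  rw [lintegral_add_right _ (Finset.measurable_fun_sum _ fun j _ => m3 j),
    lintegral_add_left (Finset.measurable_fun_sum _ fun i _ => m1 i),
    lintegral_finsetSum _ fun i _ => m1 i,
    lintegral_finsetSum _ fun i _ => Finset.measurable_fun_sum _ fun j _ => m2 i j,
    lintegral_finsetSum _ fun j _ => m3 j]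
  simp only [fun i => lintegral_finsetSum (μ := roundLaw w s) (optimalItems L K) fun j _ => m2 i j,
    lintegral_indicator_const (measurableSet_observed hsel _),
    lintegral_indicator_const (measurableSet_deceived w l ε s _ _),
    lintegral_indicator_const (measurableSet_missed hsel _ _), obsProb, mul_comm]

/-- The gap of a matched pair is charged to one of the events in `lossBound`. -/
lemma gap_le_charges {w : Fin L → unitInterval} (hw : Antitone w)
    {sel : (Fin L → ℝ) → Fin K → Fin L} {l ε : ℝ} {j₀ i₀ : Fin L} (hi₀ : ∀ i, i ≤ i₀)
    (s : Stats L) {θ : Fin L → ℝ} {W : Fin L → Bool} {i j : Fin L} (hj : j ≤ j₀)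
    (hd : 0 < gap w j₀ i - 2 * ε) (hmiss : ∀ k, sel θ k ≠ j) (hobs : Observed (sel θ) W i) :
    ENNReal.ofReal (gap w j i) ≤ obsCost (w i) l (gap w j₀ i - 2 * ε) ε (s i) +
      {x | Deceived w l ε s i j x}.indicator (fun _ => ENNReal.ofReal (gap w j i)) (θ, W) +
      {x | Missed sel j ((w j : ℝ) - ε) x}.indicator
        (fun _ => ENNReal.ofReal (gap w j i₀)) (θ, W) := by
  have hw1 := (w j).2.2
  have hw0 := (w i).2.1
  have hj' : (w j₀ : ℝ) ≤ w j := hw hj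
  have hi' : (w i₀ : ℝ) ≤ w i := hw (hi₀ i)
  -- A gap is at most `1`, so the unit deviation cost covers it. If all three tests fail, `i` itself
  -- witnesses that `j` is missed.
  by_cases h1 : ((w i : ℝ) + ε) * obsCount s i < (s i).1
  · refine le_add_right (le_add_right (le_add_right ?_))
    rw [deviationCost, if_pos (by exact h1), ← ENNReal.ofReal_one]
    exact ENNReal.ofReal_le_ofReal (by unfold gap; linarith)
  by_cases h2 : obsCount s i * (gap w j i - 2 * ε) ^ 2 < l
  · refine le_add_right (le_add_right (le_add_left (ENNReal.ofReal_le_ofReal ?_)))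
    have := le_exploration (d := gap w j₀ i - 2 * ε) (d' := gap w j i - 2 * ε) (ε := ε) hd.le
      (by unfold gap; linarith) (by unfold gap; linarith) h2
    rwa [sub_add_cancel] at this
  by_cases h3 : (w j : ℝ) - ε < θ i
  · refine le_add_right (le_add_left ?_)
    rw [Set.indicator_of_mem (s := {x | Deceived w l ε s i j x})
      ⟨⟨not_lt.mp h2, not_lt.mp h1⟩, h3⟩]
  · refine le_add_left ?_
    rw [Set.indicator_of_mem (s := {x | Missed sel j ((w j : ℝ) - ε) x})
      ⟨hmiss, i, hobs, not_lt.mp h3⟩]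
    exact ENNReal.ofReal_le_ofReal (by unfold gap; linarith)

lemma sum_matched_le_lossBound {w : Fin L → unitInterval} (hw : Antitone w)
    {sel : (Fin L → ℝ) → Fin K → Fin L} (hg : IsGreedySelection sel) {l ε : ℝ} {j₀ i₀ : Fin L}
    (hj₀ : ∀ j : Fin L, (j : ℕ) < K → j ≤ j₀) (hi₀ : ∀ i, i ≤ i₀)
    (hd : ∀ i : Fin L, K ≤ (i : ℕ) → 0 < gap w j₀ i - 2 * ε)
    (s : Stats L) (θ : Fin L → ℝ) (W : Fin L → Bool) {π : Fin K → Fin L}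
    (hπ : Function.Injective π) (hπK : ∀ k, (π k : ℕ) < K)
    (hmiss : ∀ k, K ≤ (sel θ k : ℕ) → ∀ k', sel θ k' ≠ π k) :
    ∑ k with K ≤ (sel θ k : ℕ), {W | Observed (sel θ) W (sel θ k)}.indicator
        (fun _ => ENNReal.ofReal (gap w (π k) (sel θ k))) W ≤
      lossBound w sel l ε j₀ i₀ s (θ, W) := by
  classical
  set A : Finset (Fin K) := Finset.univ.filter fun k => K ≤ (sel θ k : ℕ) with hA
  have hAsub : A.image (sel θ) ⊆ suboptimalItems L K := by
    intro i hi
    obtain ⟨k, hk, rfl⟩ := Finset.mem_image.mp hi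
    simpa [suboptimalItems, hA] using hk
  have hAopt : A.image π ⊆ optimalItems L K := by
    intro i hi
    obtain ⟨k, hk, rfl⟩ := Finset.mem_image.mp hi
    simpa [optimalItems] using hπK k
  set f1 : Fin L → ℝ≥0∞ := fun i => {x : (Fin L → ℝ) × (Fin L → Bool) |
      Observed (sel x.1) x.2 i}.indicator
        (fun _ => obsCost (w i) l (gap w j₀ i - 2 * ε) ε (s i)) (θ, W) with hf1
  set f2 : Fin L → Fin L → ℝ≥0∞ := fun i j =>
      {x | Deceived w l ε s i j x}.indicator (fun _ => ENNReal.ofReal (gap w j i)) (θ, W) with hf2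
  set f3 : Fin L → ℝ≥0∞ := fun j => {x | Missed sel j ((w j : ℝ) - ε) x}.indicator
        (fun _ => ENNReal.ofReal (gap w j i₀)) (θ, W) with hf3
  calc _ ≤ ∑ k ∈ A, (f1 (sel θ k) + f2 (sel θ k) (π k) + f3 (π k)) := by
        refine Finset.sum_le_sum fun k hk => ?_
        have hkA : K ≤ (sel θ k : ℕ) := by simpa [hA] using hk
        by_cases hobs : Observed (sel θ) W (sel θ k)
        · rw [Set.indicator_of_mem (s := {W | Observed (sel θ) W (sel θ k)}) hobs]
          simp only [hf1]
          rw [Set.indicator_of_mem (s := {x : (Fin L → ℝ) × (Fin L → Bool) |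
            Observed (sel x.1) x.2 (sel θ k)}) hobs]
          exact gap_le_charges hw hi₀ s (hj₀ _ (hπK k)) (hd _ hkA) (hmiss k hkA) hobs
        · rw [Set.indicator_of_notMem (s := {W | Observed (sel θ) W (sel θ k)}) hobs]
          exact zero_le
    _ = ∑ k ∈ A, f1 (sel θ k) + ∑ k ∈ A, f2 (sel θ k) (π k) + ∑ k ∈ A, f3 (π k) := by
        rw [Finset.sum_add_distrib, Finset.sum_add_distrib]
    _ ≤ _ := by
        refine add_le_add (add_le_add ?_ ?_) ?_
        · rw [← Finset.sum_image (f := f1) fun a _ b _ h => hg.injective θ h]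
          exact Finset.sum_le_sum_of_subset hAsub
        -- The matching depends on the samples, so the pair of `sel θ k` and `π k` is enlarged to
        -- all optimal partners; the other two sums use injectivity of one component only.
        · calc _ ≤ ∑ k ∈ A, ∑ j ∈ optimalItems L K, f2 (sel θ k) j :=
                Finset.sum_le_sum fun k hk =>
                  Finset.single_le_sum (f := fun j => f2 (sel θ k) j) (fun _ _ => zero_le)
                    (hAopt (Finset.mem_image_of_mem π hk))
            _ ≤ _ := by
              rw [← Finset.sum_image (f := fun i => ∑ j ∈ optimalItems L K, f2 i j)
                fun a _ b _ h => hg.injective θ h]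
              exact Finset.sum_le_sum_of_subset hAsub
        · rw [← Finset.sum_image (f := f3) fun a _ b _ h => hπ h]
          exact Finset.sum_le_sum_of_subset hAopt

lemma ofReal_loss_le_lintegral_lossBound (hKL : K ≤ L) {w : Fin L → unitInterval}
    (hw : Antitone w)
    {sel : (Fin L → ℝ) → Fin K → Fin L} (hg : IsGreedySelection sel) {l ε : ℝ} {j₀ i₀ : Fin L}
    (hj₀ : ∀ j : Fin L, (j : ℕ) < K → j ≤ j₀) (hi₀ : ∀ i, i ≤ i₀)
    (hd : ∀ i : Fin L, K ≤ (i : ℕ) → 0 < gap w j₀ i - 2 * ε) (s : Stats L) (θ : Fin L → ℝ) :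
    ENNReal.ofReal (expectedReward w (firstItems hKL) - expectedReward w (sel θ)) ≤
      ∫⁻ W, lossBound w sel l ε j₀ i₀ s (θ, W) ∂clickLaw w := by
  obtain ⟨π, hπ, hπK, hmiss, hle⟩ := exists_matching hKL hw (hg.injective θ)
  have hp0 : ∀ k, 0 ≤ ∏ m with m < k, (1 - (w (sel θ m) : ℝ)) := fun k =>
    Finset.prod_nonneg fun m _ => by linarith [(w (sel θ m)).2.2]
  refine (ENNReal.ofReal_le_ofReal hle).trans (le_trans (le_of_eq ?_) (lintegral_mono fun W =>
    sum_matched_le_lossBound hw hg hj₀ hi₀ hd s θ W hπ hπK hmiss))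
  rw [lintegral_finsetSum _ fun _ _ => Measurable.of_discrete,
    ENNReal.ofReal_sum_of_nonneg fun k hk => ?_]
  · refine Finset.sum_congr rfl fun k _ => ?_
    rw [lintegral_indicator_const (MeasurableSet.of_discrete), clickLaw_observed w (hg.injective θ),
      ENNReal.ofReal_mul (hp0 k), mul_comm]
  · refine mul_nonneg (hp0 k) (sub_nonneg.mpr (hw (Fin.le_def.mpr ?_)))
    exact (hπK k).le.trans (Finset.mem_filter.mp hk).2

/-! ### Summation over rounds -/

lemma ofReal_integral_le_lintegral {α : Type*} [MeasurableSpace α] {μ : Measure α} {f : α → ℝ}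
    (hf : Integrable f μ) : ENNReal.ofReal (∫ x, f x ∂μ) ≤ ∫⁻ x, ENNReal.ofReal (f x) ∂μ := by
  refine ENNReal.ofReal_le_of_le_toReal ?_
  rw [integral_eq_lintegral_pos_part_sub_lintegral_neg_part hf]
  exact sub_le_self _ ENNReal.toReal_nonneg

lemma ofReal_sum_le {ι : Type*} (s : Finset ι) (f : ι → ℝ) :
    ENNReal.ofReal (∑ i ∈ s, f i) ≤ ∑ i ∈ s, ENNReal.ofReal (f i) := by
  classical
  induction s using Finset.induction_on with
  | empty => simp
  | insert i s hi ih =>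
    rw [Finset.sum_insert hi, Finset.sum_insert hi]
    exact ENNReal.ofReal_add_le.trans (add_le_add_right ih _)

lemma expectedReward_mem_Icc (w : Fin L → unitInterval) (S : Fin K → Fin L) :
    expectedReward w S ∈ Set.Icc (0 : ℝ) 1 := by
  have h0 : ∀ l, 0 ≤ 1 - (w l : ℝ) := fun l => by linarith [(w l).2.2]
  have h1 : ∀ l, 1 - (w l : ℝ) ≤ 1 := fun l => by linarith [(w l).2.1]
  constructor
  · exact sub_nonneg.mpr (Finset.prod_le_one (fun _ _ => h0 _) fun _ _ => h1 _)
  · exact sub_le_self _ (Finset.prod_nonneg fun _ _ => h0 _)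

lemma integrable_reward (w : Fin L → unitInterval) {sel : (Fin L → ℝ) → Fin K → Fin L}
    (hsel : Measurable sel) (s : Stats L) :
    Integrable (fun θ => expectedReward w (sel θ)) (thompsonLaw s) :=
  Integrable.of_mem_Icc 0 1 ((Measurable.of_discrete (f := expectedReward w)).comp hsel).aemeasurable
    (Filter.Eventually.of_forall fun _ => expectedReward_mem_Icc w _)

lemma ofReal_roundLoss_le (w : Fin L → unitInterval) {sel : (Fin L → ℝ) → Fin K → Fin L}
    (hsel : Measurable sel) (r : ℝ) (t : ℕ) :
    ENNReal.ofReal (r - roundReward w sel t) ≤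
      ∫⁻ s, ∫⁻ θ, ENNReal.ofReal (r - expectedReward w (sel θ)) ∂thompsonLaw s
        ∂statsLaw w sel t := by
  have := isProbabilityMeasure_statsLaw w hsel t
  have hin : ∀ s, ∫ θ, (r - expectedReward w (sel θ)) ∂thompsonLaw s =
      r - ∫ θ, expectedReward w (sel θ) ∂thompsonLaw s := fun s => by
    rw [integral_sub (integrable_const r) (integrable_reward w hsel s)]; simp
  have hint : Integrable (fun s => ∫ θ, expectedReward w (sel θ) ∂thompsonLaw s)
      (statsLaw w sel t) := by
    refine Integrable.of_mem_Icc 0 1 Measurable.of_discrete.aemeasurable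
      (Filter.Eventually.of_forall fun s => ⟨?_, ?_⟩)
    · exact integral_nonneg fun θ => (expectedReward_mem_Icc w (sel θ)).1
    · refine (integral_mono (integrable_reward w hsel s) (integrable_const 1)
        fun θ => (expectedReward_mem_Icc w (sel θ)).2).trans ?_
      simp
  have e : r - roundReward w sel t =
      ∫ s, ∫ θ, (r - expectedReward w (sel θ)) ∂thompsonLaw s ∂statsLaw w sel t := by
    simp only [hin]
    rw [integral_sub (integrable_const r) hint]
    simp [roundReward]
  rw [e]
  refine (ofReal_integral_le_lintegral ?_).trans (lintegral_mono fun s =>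
    ofReal_integral_le_lintegral ((integrable_const r).sub (integrable_reward w hsel s)))
  simp only [hin]
  exact (integrable_const r).sub hint

lemma sum_lintegral_obsCost_le {w : Fin L → unitInterval} {sel : (Fin L → ℝ) → Fin K → Fin L}
    (hsel : Measurable sel) (hg : IsGreedySelection sel) (i : Fin L) {d ε : ℝ} (hε : 0 < ε)
    (hd : 0 < d) (hd1 : d ≤ 1) (T : ℕ) :
    ∑ t ∈ Finset.range T, ∫⁻ s, obsProb w sel s i * obsCost (w i) (Real.log T) d ε (s i)
        ∂statsLaw w sel t ≤
      ENNReal.ofReal (1 + 1 / ε ^ 2 + 4 * Real.log T * ((d + ε) / d ^ 2)) := by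
  have hl : 0 ≤ Real.log T := Real.log_natCast_nonneg T
  rw [ENNReal.ofReal_add (by positivity) (by positivity)]
  refine (sum_lintegral_obsProb_le hsel hg i _ T).trans ?_
  simp only [obsCost, mul_add, Finset.sum_add_distrib]
  rw [ENNReal.tsum_add]
  exact add_le_add (tsum_deviationCost_le (w i).2.1 (w i).2.2 hε)
    (tsum_exploration_le (w i).2.1 (w i).2.2 hd hd1 hε.le)

lemma sum_lintegral_missed_le {w : Fin L → unitInterval} {sel : (Fin L → ℝ) → Fin K → Fin L}
    (hsel : Measurable sel) (hg : IsGreedySelection sel) (j : Fin L) {ε : ℝ} (hε : 0 < ε)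
    (hj : ε < w j) (T : ℕ) :
    ∑ t ∈ Finset.range T, ∫⁻ s, roundLaw w s {x | Missed sel j ((w j : ℝ) - ε) x}
        ∂statsLaw w sel t ≤ ENNReal.ofReal ((4 + 20 * Real.exp 2) / ε ^ 4) := by
  refine le_trans (Finset.sum_le_sum fun t _ => lintegral_mono fun s =>
    roundLaw_missed_le (w := w) hsel hg s j (y := (w j : ℝ) - ε) (by linarith)
      (by linarith [(w j).2.2])) ?_
  exact (sum_lintegral_obsProb_le hsel hg j (fun c => ENNReal.ofReal
    (1 / binomCdf (c.1 + c.2 + 1) ((w j : ℝ) - ε) c.1 - 1)) T).trans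
    (tsum_odds_le hε hj (w j).2.2)

/-- The regret bound, for an optimal item `j₀` of least click probability and the last item `i₀`. -/
lemma ofReal_regret_le (hKL : K ≤ L) {w : Fin L → unitInterval} (hw : Antitone w)
    {sel : (Fin L → ℝ) → Fin K → Fin L} (hsel : Measurable sel) (hg : IsGreedySelection sel)
    {ε : ℝ} (hε : 0 < ε) {j₀ i₀ : Fin L}
    (hj₀ : ∀ j : Fin L, (j : ℕ) < K → j ≤ j₀) (hi₀ : ∀ i, i ≤ i₀)
    (hd : ∀ i : Fin L, K ≤ (i : ℕ) → 0 < gap w j₀ i - 2 * ε) (hj₀ε : ε < w j₀) {T : ℕ}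
    (hT : 0 < T) :
    ENNReal.ofReal (regret hKL w sel T) ≤
      ∑ i ∈ suboptimalItems L K, ENNReal.ofReal (1 + 1 / ε ^ 2 + 4 * Real.log T *
        ((gap w j₀ i - 2 * ε + ε) / (gap w j₀ i - 2 * ε) ^ 2)) +
      ∑ i ∈ suboptimalItems L K, ∑ j ∈ optimalItems L K, ENNReal.ofReal (gap w j i) +
      ∑ j ∈ optimalItems L K,
        ENNReal.ofReal ((4 + 20 * Real.exp 2) / ε ^ 4) * ENNReal.ofReal (gap w j i₀) := by
  have hsub : ∀ i ∈ suboptimalItems L K, K ≤ (i : ℕ) := fun i hi => (Finset.mem_filter.mp hi).2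
  have hopt : ∀ j ∈ optimalItems L K, (j : ℕ) < K := fun j hj => (Finset.mem_filter.mp hj).2
  have hwj : ∀ j ∈ optimalItems L K, (w j₀ : ℝ) ≤ w j := fun j hj => hw (hj₀ j (hopt j hj))
  set l := Real.log T with hl
  have hround : ∀ t ∈ Finset.range T,
      ENNReal.ofReal (expectedReward w (firstItems hKL) - roundReward w sel t) ≤
      ∑ i ∈ suboptimalItems L K, ∫⁻ s,
        obsProb w sel s i * obsCost (w i) l (gap w j₀ i - 2 * ε) ε (s i) ∂statsLaw w sel t +
      ∑ i ∈ suboptimalItems L K, ∑ j ∈ optimalItems L K,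
        ENNReal.ofReal (Real.exp (-l)) * ENNReal.ofReal (gap w j i) +
      ∑ j ∈ optimalItems L K,
        (∫⁻ s, roundLaw w s {x | Missed sel j ((w j : ℝ) - ε) x} ∂statsLaw w sel t) *
          ENNReal.ofReal (gap w j i₀) := by
    intro t _
    have := isProbabilityMeasure_statsLaw w hsel t
    refine (ofReal_roundLoss_le w hsel _ t).trans ?_
    calc _ ≤ ∫⁻ s, ∫⁻ x, lossBound w sel l ε j₀ i₀ s x ∂roundLaw w s ∂statsLaw w sel t := by
          refine lintegral_mono fun s => ?_
          rw [roundLaw, lintegral_prod _ (measurable_lossBound w hsel l ε j₀ i₀ s).aemeasurable]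
          exact lintegral_mono fun θ =>
            ofReal_loss_le_lintegral_lossBound hKL hw hg hj₀ hi₀ hd s θ
      _ ≤ ∫⁻ s, (∑ i ∈ suboptimalItems L K,
            obsProb w sel s i * obsCost (w i) l (gap w j₀ i - 2 * ε) ε (s i) +
          ∑ i ∈ suboptimalItems L K, ∑ j ∈ optimalItems L K,
            ENNReal.ofReal (Real.exp (-l)) * ENNReal.ofReal (gap w j i) +
          ∑ j ∈ optimalItems L K, roundLaw w s {x | Missed sel j ((w j : ℝ) - ε) x} *
            ENNReal.ofReal (gap w j i₀)) ∂statsLaw w sel t := by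
          refine lintegral_mono fun s => ?_
          rw [lintegral_lossBound w hsel]
          refine add_le_add_left (add_le_add_right (Finset.sum_le_sum fun i hi =>
            Finset.sum_le_sum fun j hj => mul_le_mul_left ?_ _) _) _
          refine roundLaw_deceived_le s hε ((hd i (hsub i hi)).trans_le ?_)
          unfold gap
          linarith [hwj j hj]
      _ = _ := by
          rw [lintegral_add_left Measurable.of_discrete, lintegral_add_left Measurable.of_discrete,
            lintegral_finsetSum _ fun _ _ => Measurable.of_discrete]
          simp only [lintegral_const, measure_univ, mul_one]
          rw [lintegral_finsetSum _ fun _ _ => Measurable.of_discrete]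
          simp only [lintegral_mul_const' _ _ ENNReal.ofReal_ne_top]
  have hreg : regret hKL w sel T =
      ∑ t ∈ Finset.range T, (expectedReward w (firstItems hKL) - roundReward w sel t) := by
    rw [regret, Finset.sum_sub_distrib]
    simp
  rw [hreg]
  refine (ofReal_sum_le _ _).trans ((Finset.sum_le_sum hround).trans ?_)
  rw [Finset.sum_add_distrib, Finset.sum_add_distrib]
  refine add_le_add (add_le_add ?_ ?_) ?_
  · rw [Finset.sum_comm]
    refine Finset.sum_le_sum fun i hi =>
      sum_lintegral_obsCost_le hsel hg i hε (hd i (hsub i hi)) ?_ T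
    have := (w j₀).2.2
    have := (w i).2.1
    unfold gap
    linarith
  · rw [Finset.sum_const, Finset.card_range, nsmul_eq_mul]
    simp only [← Finset.mul_sum]
    -- `T` rounds at probability `exp (-log T) = 1 / T` each contribute every gap once.
    rw [← mul_assoc, ← ENNReal.ofReal_natCast, ← ENNReal.ofReal_mul (by positivity), Real.exp_neg,
      Real.exp_log (by exact_mod_cast hT), mul_inv_cancel₀ (by exact_mod_cast hT.ne'),
      ENNReal.ofReal_one, one_mul]
  · rw [Finset.sum_comm]
    refine Finset.sum_le_sum fun j hj => ?_
    rw [← Finset.sum_mul]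
    exact mul_le_mul_left (sum_lintegral_missed_le hsel hg j hε
      (hj₀ε.trans_le (hwj j hj)) T) _

lemma card_suboptimalItems (hKL : K ≤ L) : ((suboptimalItems L K).card : ℝ) = (L : ℝ) - K := by
  have h2 : suboptimalItems L K = (optimalItems L K)ᶜ := by
    ext j; simp [suboptimalItems, optimalItems]
  rw [h2, Finset.card_compl, optimalItems_eq_map hKL, Finset.card_map, Finset.card_univ, Fintype.card_fin,
    Fintype.card_fin, Nat.cast_sub hKL]

lemma regret_le (hKL : K ≤ L) {w : Fin L → unitInterval} (hw : Antitone w)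
    {sel : (Fin L → ℝ) → Fin K → Fin L} (hsel : Measurable sel) (hg : IsGreedySelection sel)
    {ε : ℝ} (hε : 0 < ε) {j₀ i₀ : Fin L}
    (hj₀ : ∀ j : Fin L, (j : ℕ) < K → j ≤ j₀) (hi₀ : ∀ i, i ≤ i₀)
    (hd : ∀ i : Fin L, K ≤ (i : ℕ) → 0 < gap w j₀ i - 2 * ε) (hj₀ε : ε < w j₀) (T : ℕ) :
    regret hKL w sel T ≤
      ((L : ℝ) - K) * (1 + 1 / ε ^ 2)
      + 4 * Real.log T * ∑ i ∈ suboptimalItems L K,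
          (gap w j₀ i - ε) / (gap w j₀ i - 2 * ε) ^ 2
      + ∑ i ∈ suboptimalItems L K, ∑ j ∈ optimalItems L K, gap w j i
      + (4 + 20 * Real.exp 2) / ε ^ 4 * ∑ j ∈ optimalItems L K, gap w j i₀ := by
  have hl : 0 ≤ Real.log T := Real.log_natCast_nonneg T
  have hopt : ∀ j ∈ optimalItems L K, ∀ i : Fin L, K ≤ (i : ℕ) → 0 ≤ gap w j i := by
    intro j hj i hi
    have : (w i : ℝ) ≤ w j :=
      hw (Fin.le_def.mpr ((Finset.mem_filter.mp hj).2.le.trans hi))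
    unfold gap; linarith
  have hopt' : ∀ j ∈ optimalItems L K, 0 ≤ gap w j i₀ := by
    intro j hj
    have : (w i₀ : ℝ) ≤ w j := hw (hi₀ j)
    unfold gap; linarith
  have hsub : ∀ i ∈ suboptimalItems L K, K ≤ (i : ℕ) := fun i hi => (Finset.mem_filter.mp hi).2
  have h1 : ∀ i ∈ suboptimalItems L K, 0 ≤ 1 + 1 / ε ^ 2 + 4 * Real.log T *
        ((gap w j₀ i - 2 * ε + ε) / (gap w j₀ i - 2 * ε) ^ 2) := by
    intro i hi
    have := hd i (hsub i hi)
    positivity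
  have h2 : 0 ≤ ∑ i ∈ suboptimalItems L K, ∑ j ∈ optimalItems L K, gap w j i :=
    Finset.sum_nonneg fun i hi => Finset.sum_nonneg fun j hj => hopt j hj i (hsub i hi)
  have h3 : 0 ≤ (4 + 20 * Real.exp 2) / ε ^ 4 * ∑ j ∈ optimalItems L K, gap w j i₀ :=
    mul_nonneg (by positivity) (Finset.sum_nonneg hopt')
  have e : ((L : ℝ) - K) * (1 + 1 / ε ^ 2)
      + 4 * Real.log T * ∑ i ∈ suboptimalItems L K,
          (gap w j₀ i - ε) / (gap w j₀ i - 2 * ε) ^ 2 =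
      ∑ i ∈ suboptimalItems L K, (1 + 1 / ε ^ 2 + 4 * Real.log T *
        ((gap w j₀ i - 2 * ε + ε) / (gap w j₀ i - 2 * ε) ^ 2)) := by
    rw [Finset.sum_add_distrib, Finset.sum_const, nsmul_eq_mul, card_suboptimalItems hKL,
      Finset.mul_sum]
    congr 1
    refine Finset.sum_congr rfl fun i _ => ?_
    ring
  rw [e]
  have h1' := Finset.sum_nonneg h1
  -- The identity `exp (log T) = T` fails at `T = 0`, where the regret is zero.
  rcases Nat.eq_zero_or_pos T with rfl | hT
  · have : regret hKL w sel 0 = 0 := by simp [regret]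
    rw [this]
    positivity
  · refine (ENNReal.ofReal_le_ofReal_iff (by positivity)).mp ?_
    refine (ofReal_regret_le hKL hw hsel hg hε hj₀ hi₀ hd hj₀ε hT).trans (le_of_eq ?_)
    rw [ENNReal.ofReal_add (by positivity) h3, ENNReal.ofReal_add h1' h2,
      ENNReal.ofReal_sum_of_nonneg h1, ENNReal.ofReal_mul (by positivity),
      ENNReal.ofReal_sum_of_nonneg hopt', ENNReal.ofReal_sum_of_nonneg fun i hi =>
        Finset.sum_nonneg fun j hj => hopt j hj i (hsub i hi), Finset.mul_sum]
    congr 2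
    exact Finset.sum_congr rfl fun i hi =>
      (ENNReal.ofReal_sum_of_nonneg fun j hj => hopt j hj i (hsub i hi)).symm

/-- With `u = x - 2 * (D / 3) ≥ D / 3`, the left side is `1 / u + (D / 3) / u ^ 2 ≤ 3 / D + 3 / D`.
-/
lemma gap_ratio_le {x D : ℝ} (hD : 0 < D) (hx : D ≤ x) :
    (x - D / 3) / (x - 2 * (D / 3)) ^ 2 ≤ 6 / D := by
  have h : 0 < x - 2 * (D / 3) := by linarith
  rw [div_le_div_iff₀ (by positivity) hD]
  nlinarith [mul_nonneg (sub_nonneg.mpr hx) hD.le, sq_nonneg (x - D)]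

end CascadingBandit

/-! ### The theorem -/

theorem theorem2 :
    ∃ a : ℝ, 0 < a ∧
      ∀ (L K : ℕ) (hK : 1 ≤ K) (hKL : K < L) (w : Fin L → unitInterval)
        (sel : (Fin L → ℝ) → Fin K → Fin L),
        Measurable sel → CascadingBandit.IsGreedySelection sel →
        Antitone w →
        w ⟨K, hKL⟩ < w ⟨K - 1, by omega⟩ →
        (∀ (T : ℕ) (ε : ℝ), 0 < ε →
          0 < CascadingBandit.gap w ⟨K - 1, by omega⟩ ⟨K, hKL⟩ - 2 * ε →
          CascadingBandit.regret hKL.le w sel T ≤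
            ((L : ℝ) - K) * (1 + 1 / ε ^ 2)
            + 4 * Real.log T * ∑ i ∈ CascadingBandit.suboptimalItems L K,
                (CascadingBandit.gap w ⟨K - 1, by omega⟩ i - ε) /
                  (CascadingBandit.gap w ⟨K - 1, by omega⟩ i - 2 * ε) ^ 2
            + ∑ i ∈ CascadingBandit.suboptimalItems L K, ∑ j ∈ CascadingBandit.optimalItems L K,
                CascadingBandit.gap w j i
            + a / ε ^ 4 * ∑ j ∈ CascadingBandit.optimalItems L K,
                CascadingBandit.gap w j ⟨L - 1, by omega⟩) ∧
        (∀ T : ℕ,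
          CascadingBandit.regret hKL.le w sel T ≤
            24 * (((L : ℝ) - K) * Real.log T /
              CascadingBandit.gap w ⟨K - 1, by omega⟩ ⟨K, hKL⟩)
            + (((L : ℝ) - K) *
                (1 + 9 / CascadingBandit.gap w ⟨K - 1, by omega⟩ ⟨K, hKL⟩ ^ 2)
              + ∑ i ∈ CascadingBandit.suboptimalItems L K, ∑ j ∈ CascadingBandit.optimalItems L K,
                  CascadingBandit.gap w j i
              + 81 * a / CascadingBandit.gap w ⟨K - 1, by omega⟩ ⟨K, hKL⟩ ^ 4 *
                  ∑ j ∈ CascadingBandit.optimalItems L K,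
                    CascadingBandit.gap w j ⟨L - 1, by omega⟩)) := by
  refine ⟨4 + 20 * Real.exp 2, by positivity, ?_⟩
  intro L K hK hKL w sel hsel hg hw _
  set j₀ : Fin L := ⟨K - 1, by omega⟩ with hj₀_def
  set i₀ : Fin L := ⟨L - 1, by omega⟩ with hi₀_def
  set c₀ : Fin L := ⟨K, hKL⟩ with hc₀_def
  have hj₀ : ∀ j : Fin L, (j : ℕ) < K → j ≤ j₀ := fun j hj => by
    rw [Fin.le_def]; simp only [hj₀_def]; omega
  have hi₀ : ∀ i : Fin L, i ≤ i₀ := fun i => by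
    rw [Fin.le_def]; simp only [hi₀_def]; omega
  have hgap : ∀ i : Fin L, K ≤ (i : ℕ) →
      CascadingBandit.gap w j₀ c₀ ≤ CascadingBandit.gap w j₀ i := fun i hi => by
    have : (w i : ℝ) ≤ w c₀ := hw (Fin.le_def.mpr hi)
    unfold CascadingBandit.gap; linarith
  have main : ∀ (T : ℕ) (ε : ℝ), 0 < ε → 0 < CascadingBandit.gap w j₀ c₀ - 2 * ε → _ :=
    fun T ε hε hd => CascadingBandit.regret_le hKL.le hw hsel hg hε hj₀ hi₀
      (fun i hi => by linarith [hgap i hi])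
      -- The gap is at most `w j₀`, so `2 * ε < w j₀`, which gives the required `ε < w j₀`.
      (by unfold CascadingBandit.gap at hd; linarith [(w c₀).2.1]) T
  refine ⟨main, fun T => ?_⟩
  set D := CascadingBandit.gap w j₀ c₀ with hD_def
  have hD : 0 < D := by
    have : (w c₀ : ℝ) < w j₀ := by assumption
    simp only [hD_def, CascadingBandit.gap]; linarith
  -- The choice `ε = D / 3` leaves `D - 2 * ε = D / 3` and produces the constants `9`, `81` and `24
  -- = 4 * 6`.
  have h := main T (D / 3) (by positivity) (by linarith)
  have hl : 0 ≤ Real.log T := Real.log_natCast_nonneg T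
  have hsum : ∑ i ∈ CascadingBandit.suboptimalItems L K,
      (CascadingBandit.gap w j₀ i - D / 3) / (CascadingBandit.gap w j₀ i - 2 * (D / 3)) ^ 2 ≤
      ((L : ℝ) - K) * (6 / D) := by
    rw [← CascadingBandit.card_suboptimalItems hKL.le, ← nsmul_eq_mul]
    exact Finset.sum_le_card_nsmul _ _ _ fun i hi =>
      CascadingBandit.gap_ratio_le hD (hgap i (Finset.mem_filter.mp hi).2)
  have h4 : 4 * Real.log T * ∑ i ∈ CascadingBandit.suboptimalItems L K,
      (CascadingBandit.gap w j₀ i - D / 3) / (CascadingBandit.gap w j₀ i - 2 * (D / 3)) ^ 2 ≤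
      24 * (((L : ℝ) - K) * Real.log T / D) := by
    calc _ ≤ 4 * Real.log T * (((L : ℝ) - K) * (6 / D)) := by gcongr
      _ = _ := by ring
  have e1 : 1 / (D / 3) ^ 2 = 9 / D ^ 2 := by field_simp; norm_num
  have e2 : (4 + 20 * Real.exp 2) / (D / 3) ^ 4 = 81 * (4 + 20 * Real.exp 2) / D ^ 4 := by
    field_simp; norm_num
  rw [e1, e2] at h
  linarith
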